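/- Let $n\ge 1$, $\sigma\in[0,2]$, $s\ge 0$ and $m\in[1,2]$. Consider the Cauchy problem in $\mathbb{R}^n$ $$u_{tt}+\Delta^2u+\Delta\theta+(-\Delta)^{\sigma}u_t=0,\qquad \theta_t-\Delta\theta-\Delta u_t=0,\qquad (u,u_t,\theta)(0,\cdot)=(u_0,u_1,\theta_0),$$ where $u_0$ is a tempered distribution with $|D|^2u_0=-\Delta u_0\in H^s(\mathbb{R}^n)\cap L^m(\mathbb{R}^n)$ and $u_1,\theta_0\in H^s(\mathbb{R}^n)\cap L^m(\mathbb{R}^n)$. By a solution we mean a pair $(u,\theta)$ with $|D|^2u,\ u_t,\ \theta\in\mathcal{C}([0,\infty),L^2(\mathbb{R}^n))$ that satisfies the equations for all $t\ge0$ in the sense of tempered distributions in $x$ and attains the initial data; $(-\Delta)^\sigma$ and $|D|^s$ are the Fourier multipliers with symbols $|\xi|^{2\sigma}$ and $|\xi|^{s}$, and $\|f\|_{\dot H^s}=\||D|^sf\|_{L^2}$. Put $$\gamma(\sigma,n,m,s)=\begin{cases}\dfrac{(2-m)n+2ms}{4m(2-\sigma)}&\text{if }\sigma\in[0,1),\\[2mm]\dfrac{(2-m)n+2ms}{4m}&\text{if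 }\sigma\in[1,2].\end{cases}$$ Then there is a constant $C>0$ depending only on $\sigma,n,m,s$ such that, for all such data, the solution satisfies for every $t\ge0$ $$\||D|^2u(t,\cdot)\|_{\dot H^s}+\|u_t(t,\cdot)\|_{\dot H^s}+\|\theta(t,\cdot)\|_{\dot H^s}\le C(1+t)^{-\gamma(\sigma,n,m,s)}\sum_{f\in\{|D|^2u_0,\,u_1,\,\theta_0\}}\big(\|f\|_{H^s}+\|f\|_{L^m}\big).$$ -/

import Mathlib

open MeasureTheory
open scoped SchwartzMap FourierTransform Laplacian ENNReal

noncomputable section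

namespace ThermoPlate

/-- Complex-valued square-integrable functions on `ℝⁿ`. -/
abbrev L2 (n : ℕ) : Type := Lp ℂ 2 (volume : Measure (EuclideanSpace ℝ (Fin n)))

/-- Tempered distributions on `ℝⁿ`. -/
abbrev Distr (n : ℕ) : Type := 𝓢'(EuclideanSpace ℝ (Fin n), ℂ)

/-- Schwartz functions on `ℝⁿ`. -/
abbrev Test (n : ℕ) : Type := 𝓢(EuclideanSpace ℝ (Fin n), ℂ)

/-- The modulus of the frequency. In the normalisation `𝓕 f ξ = ∫ exp (-2 π i x·ξ) f x` used by
Mathlib, the operator `|D|` (the square root of `-Δ`) has the symbol `2 π ‖ξ‖`. -/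
def freq {n : ℕ} (ξ : EuclideanSpace ℝ (Fin n)) : ℝ := 2 * Real.pi * ‖ξ‖

/-- The homogeneous Sobolev norm `‖f‖_{Ḣˢ} = ‖ |D|ˢ f ‖_{L²}`, with the value `∞` when
`f` is not in `Ḣˢ`. -/
def hdotNorm {n : ℕ} (s : ℝ) (f : L2 n) : ℝ≥0∞ :=
  eLpNorm (fun ξ => ((freq ξ ^ s : ℝ) : ℂ) * (𝓕 f : L2 n) ξ) 2 volume

/-- The inhomogeneous Sobolev norm `‖f‖_{Hˢ} = ‖ (1 + |D|²)^{s/2} f ‖_{L²}`, with the value `∞` when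
`f` is not in `Hˢ`. -/
def hNorm {n : ℕ} (s : ℝ) (f : L2 n) : ℝ≥0∞ :=
  eLpNorm (fun ξ => (((1 + freq ξ ^ 2) ^ (s / 2) : ℝ) : ℂ) * (𝓕 f : L2 n) ξ) 2 volume

/-- Membership in `Hˢ ∩ Lᵐ`, for `s ≥ 0` and real `m ≥ 1`. -/
def MemHsLm {n : ℕ} (m s : ℝ) (f : L2 n) : Prop :=
  hNorm s f < ∞ ∧ MemLp (f : EuclideanSpace ℝ (Fin n) → ℂ) (ENNReal.ofReal m) volume

/-- The norm of `Hˢ ∩ Lᵐ`. -/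
def hsLmNorm {n : ℕ} (m s : ℝ) (f : L2 n) : ℝ≥0∞ :=
  hNorm s f + eLpNorm (f : EuclideanSpace ℝ (Fin n) → ℂ) (ENNReal.ofReal m) volume

/-- The action on a test function `φ` of the tempered distribution `(-Δ)^σ f`, for `f` in `L²`. This
is the Fourier multiplier with symbol `|ξ|^{2σ}`; since that symbol need not be smooth at the
origin, the distribution is written out as an integral on the Fourier side, with the convention
that the inverse Fourier transform of a distribution `T` is `φ ↦ T (𝓕⁻ φ)`. -/
def fracLaplacian {n : ℕ} (σ : ℝ) (f : L2 n) (φ : Test n) : ℂ :=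
  ∫ ξ, (((freq ξ ^ (2 * σ) : ℝ) : ℂ) * (𝓕 f : L2 n) ξ) * (𝓕⁻ φ : Test n) ξ

/-- `(u, θ)`, together with `p = |D|²u = -Δu` and `v = u_t`, is a solution on `[0, ∞) × ℝⁿ` of

  `u_tt + Δ²u + Δθ + (-Δ)^σ u_t = 0`,
  `θ_t - Δθ - Δu_t = 0`,
  `(u, u_t, θ)(0) = (u₀, u₁, θ₀)`,

in the class `|D|²u, u_t, θ ∈ C([0, ∞), L²)`. All equations are equations between tempered
distributions in `x`: they are tested with Schwartz functions of `x`, for every time `t ≥ 0`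
(with the one-sided derivative at `t = 0`). -/
structure IsSolution {n : ℕ} (σ : ℝ) (u₀ : Distr n) (u₁ θ₀ : L2 n)
    (u : ℝ → Distr n) (p v θ : ℝ → L2 n) : Prop where
  /-- `|D|²u = p`. -/
  neg_laplacian_u : ∀ t, 0 ≤ t → -Δ (u t) = (p t : Distr n)
  continuousOn_p : ContinuousOn p (Set.Ici 0)
  continuousOn_v : ContinuousOn v (Set.Ici 0)
  continuousOn_θ : ContinuousOn θ (Set.Ici 0)
  /-- `u_t = v`. -/
  hasDeriv_u : ∀ φ : Test n, ∀ t, 0 ≤ t →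
    HasDerivWithinAt (fun τ => u τ φ) ((v t : Distr n) φ) (Set.Ici 0) t
  /-- `u_tt = -(Δ²u + Δθ + (-Δ)^σ u_t)`. -/
  hasDeriv_v : ∀ φ : Test n, ∀ t, 0 ≤ t →
    HasDerivWithinAt (fun τ => (v τ : Distr n) φ)
      (-((Δ (Δ (u t))) φ + (Δ (θ t : Distr n)) φ + fracLaplacian σ (v t) φ)) (Set.Ici 0) t
  /-- `θ_t = Δθ + Δu_t`. -/
  hasDeriv_θ : ∀ φ : Test n, ∀ t, 0 ≤ t →
    HasDerivWithinAt (fun τ => (θ τ : Distr n) φ)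
      ((Δ (θ t : Distr n)) φ + (Δ (v t : Distr n)) φ) (Set.Ici 0) t
  initial_u : u 0 = u₀
  initial_v : v 0 = u₁
  initial_θ : θ 0 = θ₀

/-- The decay exponent `γ(σ, n, m, s)`. -/
def decayRate (σ : ℝ) (n : ℕ) (m s : ℝ) : ℝ :=
  if σ < 1 then ((2 - m) * n + 2 * m * s) / (4 * m * (2 - σ))
  else ((2 - m) * n + 2 * m * s) / (4 * m)

end ThermoPlate

end

/-! On the Fourier side put a = |ξ|² and b = |ξ|^{2σ}. For p = |D|²u, v = u_t and θ the system
becomes the ODE p' = av, v' = aθ - ap - bv, θ' = -aθ - av. The energy |p|² + |v|² + |θ|² loses only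
b|v|² and a|θ|². Small multiples of k Re⟨v, θ⟩ and k Re⟨p, v⟩ recover the missing damping when k ≤ 1
and kb ≤ a, which leads to k = a / max(a, b) (`quadratic_dissipation`, `lyap_dissipation`). Each
frequency then decays at the rate ka, up to a constant (`IsSolution.ae_norm_fourier_le`).

For |ξ| ≥ 1 and σ ≤ 2 this rate is at least 1, so the decay is exponential and the Hˢ norm suffices.
For |ξ| ≤ 1 the rate is at least |ξ|^α, with α = 4 - 2σ if σ < 1 and α = 2 otherwise. The multiplier
|ξ|^s exp(-c|ξ|^α T) is bounded by T^{-s/α} and has L² norm of order T^{-(s+n/2)/α}. Interpolating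
these two bounds with weights 2 - 2/m and 2/m - 1 (`eLpNorm_mul_fourier_le`) gives an Lᵐ–L² bound
whose exponent is exactly γ (`decayRate_eq`).

Solutions are only weak in x, so the ODE is not available pointwise in ξ. Multiplying the Fourier
transform by (1+‖ξ‖²)^{-2} makes all symbols bounded, and the equations become strong ODEs in L².
The Lyapunov functional is integrated over arbitrary measurable sets of frequencies, which gives the
bound for almost every ξ. -/

noncomputable section

namespace ThermoPlate

/-! ### Bounded multipliers on L²; from weak to strong derivatives. -/

section Multipliers

variable {n : ℕ}

/-- Frequency space. -/
abbrev Freq (n : ℕ) : Type := EuclideanSpace ℝ (Fin n)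

/-- Multiplication by an essentially bounded real function, as an operator on `L²`. -/
def mulL (a : Freq n → ℝ) (ha : MemLp a ∞ volume) : L2 n →L[ℝ] L2 n :=
  (ContinuousLinearMap.lsmul ℝ ℝ : ℝ →L[ℝ] ℂ →L[ℝ] ℂ).holderL volume ∞ 2 2 (ha.toLp a)

theorem coeFn_mulL (a : Freq n → ℝ) (ha : MemLp a ∞ volume) (f : L2 n) :
    mulL a ha f =ᵐ[volume] fun ξ => (a ξ : ℂ) * f ξ := by
  have h := (ContinuousLinearMap.lsmul ℝ ℝ : ℝ →L[ℝ] ℂ →L[ℝ] ℂ).coeFn_holder (r := 2)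
    (ha.toLp a) f
  filter_upwards [h, ha.coeFn_toLp] with ξ h1 h2
  rw [mulL, ContinuousLinearMap.holderL_apply_apply, h1, h2]
  simp

/-- The difference between `f` and f(0) + ∫ g has zero derivative against every test function, so it
vanishes as a distribution. The embedding of L² into distributions is injective, so it vanishes in
L². -/
theorem hasDerivWithinAt_of_weak {f g : ℝ → L2 n}
    (hg : ContinuousOn g (Set.Ici 0))
    (h : ∀ ψ : Test n, ∀ t, 0 ≤ t →
      HasDerivWithinAt (fun τ => (f τ : Distr n) ψ) ((g t : Distr n) ψ) (Set.Ici 0) t)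
    {t : ℝ} (ht : 0 ≤ t) : HasDerivWithinAt f (g t) (Set.Ici 0) t := by
  -- Freezing `g` at its initial value for negative times gives continuity on all of ℝ, hence a
  -- two-sided derivative of the primitive.
  set G : ℝ → L2 n := fun τ => g (max τ 0) with hG
  have hGc : Continuous G :=
    hg.comp_continuous (by fun_prop) (fun x => Set.mem_Ici.2 (le_max_right _ _))
  set F : ℝ → L2 n := fun τ => f 0 + ∫ x in (0 : ℝ)..τ, G x with hF
  have hFd : ∀ τ, HasDerivAt F (G τ) τ := fun τ =>
    (intervalIntegral.integral_hasDerivAt_right (hGc.intervalIntegrable _ _)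
      (hGc.stronglyMeasurableAtFilter _ _) hGc.continuousAt).const_add _
  have heq : ∀ τ, 0 ≤ τ → f τ = F τ := by
    intro τ hτ
    have hker := Lp.ker_toTemperedDistributionCLM_eq_bot (E := Freq n) (F := ℂ) (μ := volume)
      (p := 2)
    rw [LinearMap.ker_eq_bot'] at hker
    rw [← sub_eq_zero]
    apply hker
    ext ψ
    let Λ : L2 n →L[ℝ] ℂ := (PointwiseConvergenceCLM.evalCLM (RingHom.id ℂ) ℂ ψ ∘L
      Lp.toTemperedDistributionCLM ℂ volume 2).restrictScalars ℝ
    have hΛ : ∀ x : L2 n, Λ x = (x : Distr n) ψ := fun x => rfl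
    change Λ (f τ - F τ) = 0
    have hd : ∀ x, 0 ≤ x → HasDerivWithinAt (fun y => Λ (f y - F y)) 0 (Set.Ici 0) x := by
      intro x hx
      have h1 := h ψ x hx
      have h2 := (Λ.hasFDerivAt.comp_hasDerivAt x (hFd x)).hasDerivWithinAt (s := Set.Ici 0)
      have h3 := h1.sub h2
      have e : Λ (G x) = (g x : Distr n) ψ := by simp [hG, hx, hΛ]
      rw [e, sub_self] at h3
      refine h3.congr_of_mem (fun y _ => ?_) hx
      rw [map_sub]
      rfl
    have hc := constant_of_has_deriv_right_zero (f := fun y => Λ (f y - F y)) (a := 0) (b := τ)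
      (fun x hx => ((hd x hx.1).continuousWithinAt).mono Set.Icc_subset_Ici_self)
      (fun x hx => (hd x hx.1).mono (Set.Ici_subset_Ici.2 hx.1)) τ ⟨hτ, le_rfl⟩
    rw [hc]
    simp [hF]
  refine ((hFd t).hasDerivWithinAt.congr (fun τ hτ => heq τ hτ) (heq t ht)).congr_deriv ?_
  simp [hG, ht]

end Multipliers

/-! ### The system on the Fourier side, as an ODE in weighted L². -/

section WeightedEquations

variable {n : ℕ}

theorem freq_nonneg (ξ : Freq n) : 0 ≤ freq ξ := by unfold freq; positivity

theorem continuous_freq : Continuous (freq (n := n)) := by unfold freq; fun_prop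

/-- A smooth positive weight which makes the symbols of order at most four bounded. -/
def weight (ξ : Freq n) : ℝ := (1 + ‖ξ‖ ^ 2) ^ (-2 : ℝ)

theorem weight_pos (ξ : Freq n) : 0 < weight ξ := by unfold weight; positivity

theorem weight_le_one (ξ : Freq n) : weight ξ ≤ 1 :=
  Real.rpow_le_one_of_one_le_of_nonpos (by nlinarith [sq_nonneg ‖ξ‖]) (by norm_num)

theorem continuous_weight : Continuous (weight (n := n)) := by
  unfold weight
  refine Continuous.rpow_const (by fun_prop) fun ξ => Or.inl ?_
  positivity

/-- Order four is what the damping symbol |ξ|^{2σ} can reach, since σ ≤ 2. -/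
theorem weight_mul_rpow_le (ξ : Freq n) {q : ℝ} (hq : q ∈ Set.Icc (0 : ℝ) 4) :
    weight ξ * freq ξ ^ q ≤ 1 + (2 * Real.pi) ^ 4 := by
  have hr := freq_nonneg ξ
  have h1 : freq ξ ^ q ≤ 1 + freq ξ ^ 4 := by
    rcases le_total (freq ξ) 1 with h | h
    · have := Real.rpow_le_one hr h hq.1
      nlinarith [pow_nonneg hr 4]
    · have := Real.rpow_le_rpow_of_exponent_le h hq.2
      rw [show (4 : ℝ) = ((4 : ℕ) : ℝ) by norm_num, Real.rpow_natCast] at this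
      linarith
  have h2 : weight ξ * freq ξ ^ 4 ≤ (2 * Real.pi) ^ 4 := by
    have hpos : (0 : ℝ) < 1 + ‖ξ‖ ^ 2 := by positivity
    have e : weight ξ = ((1 + ‖ξ‖ ^ 2) ^ 2)⁻¹ := by
      unfold weight
      rw [Real.rpow_neg hpos.le]
      norm_num
    rw [e, inv_mul_le_iff₀ (by positivity), freq, mul_pow]
    rw [mul_comm]
    gcongr
    nlinarith [sq_nonneg ‖ξ‖]
  have := mul_le_mul_of_nonneg_left h1 (weight_pos ξ).le
  linarith [weight_le_one ξ]

theorem memLp_weight : MemLp (weight (n := n)) ∞ volume :=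
  memLp_top_of_bound continuous_weight.aestronglyMeasurable 1 <| .of_forall fun ξ => by
    rw [Real.norm_of_nonneg (weight_pos ξ).le]
    exact weight_le_one ξ

theorem measurable_freq_rpow (q : ℝ) : Measurable fun ξ : Freq n => freq ξ ^ q :=
  continuous_freq.measurable.pow_const q

theorem memLp_weight_mul_rpow {q : ℝ} (hq : q ∈ Set.Icc (0 : ℝ) 4) :
    MemLp (fun ξ : Freq n => weight ξ * freq ξ ^ q) ∞ volume :=
  memLp_top_of_bound
    (continuous_weight.measurable.mul (measurable_freq_rpow q)).aestronglyMeasurable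
    (1 + (2 * Real.pi) ^ 4) <| .of_forall fun ξ => by
    rw [Real.norm_of_nonneg (mul_nonneg (weight_pos ξ).le (Real.rpow_nonneg (freq_nonneg ξ) q))]
    exact weight_mul_rpow_le ξ hq

theorem memLp_weight_mul_sq : MemLp (fun ξ : Freq n => weight ξ * freq ξ ^ 2) ∞ volume := by
  simpa using memLp_weight_mul_rpow (n := n) (q := (2 : ℕ)) ⟨by norm_num, by norm_num⟩

theorem hasTemperateGrowth_freq_sq :
    (fun ξ : Freq n => ((freq ξ ^ 2 : ℝ) : ℂ)).HasTemperateGrowth := by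
  simp only [freq, mul_pow]
  fun_prop

theorem hasTemperateGrowth_weight :
    (fun ξ : Freq n => ((weight ξ : ℝ) : ℂ)).HasTemperateGrowth := by
  unfold weight
  fun_prop

theorem coe_apply_fourier (f : L2 n) (ψ : Test n) :
    (f : Distr n) (𝓕 ψ) = ((𝓕 f : L2 n) : Distr n) ψ := by
  rw [← TemperedDistribution.fourier_apply, Lp.fourier_toTemperedDistribution_eq]

theorem laplacian_apply_fourier (T : Distr n) (ψ : Test n) :
    (Δ T) (𝓕 ψ) = -T (𝓕 (SchwartzMap.smulLeftCLM ℂ (fun ξ => ((freq ξ ^ 2 : ℝ) : ℂ)) ψ)) := by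
  have hg : (fun ξ : Freq n => ((‖ξ‖ ^ 2 : ℝ) : ℂ)).HasTemperateGrowth := by fun_prop
  have e : (fun ξ : Freq n => ((freq ξ ^ 2 : ℝ) : ℂ)) =
      (((2 * Real.pi) ^ 2 : ℝ) : ℂ) • fun ξ : Freq n => ((‖ξ‖ ^ 2 : ℝ) : ℂ) := by
    ext ξ
    simp [freq, mul_pow]
  rw [TemperedDistribution.laplacian_eq_fourierMultiplierCLM, e, SchwartzMap.smulLeftCLM_smul hg]
  simp [FourierTransform.fourier_smul]

theorem mulL_coe_apply {a : Freq n → ℝ} (ha : MemLp a ∞ volume)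
    (ha' : (fun ξ => ((a ξ : ℝ) : ℂ)).HasTemperateGrowth) (f : L2 n) (ψ : Test n) :
    (f : Distr n) (SchwartzMap.smulLeftCLM ℂ (fun ξ => ((a ξ : ℝ) : ℂ)) ψ) =
      (mulL a ha f : Distr n) ψ := by
  rw [Lp.toTemperedDistribution_apply, Lp.toTemperedDistribution_apply]
  refine integral_congr_ae ?_
  filter_upwards [coeFn_mulL a ha f] with ξ hξ
  rw [hξ, SchwartzMap.smulLeftCLM_apply_apply ha']
  simp only [smul_eq_mul]
  ring

/-- The weighted Fourier transform. -/
def wF (f : L2 n) : L2 n := mulL weight memLp_weight (𝓕 f)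

/-- The Fourier transform multiplied by the weight and the symbol `|ξ|²`. -/
def wF2 (f : L2 n) : L2 n := mulL (fun ξ => weight ξ * freq ξ ^ 2) memLp_weight_mul_sq (𝓕 f)

/-- The Fourier transform multiplied by the weight and the symbol `|ξ|^q`. -/
def wFq {q : ℝ} (hq : q ∈ Set.Icc (0 : ℝ) 4) (f : L2 n) : L2 n :=
  mulL (fun ξ => weight ξ * freq ξ ^ q) (memLp_weight_mul_rpow hq) (𝓕 f)

theorem continuous_fourier_L2 : Continuous fun f : L2 n => (𝓕 f : L2 n) :=
  (Lp.fourierTransformₗᵢ (Freq n) ℂ).continuous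

theorem continuous_wF2 : Continuous (wF2 (n := n)) :=
  (mulL _ _).continuous.comp continuous_fourier_L2

theorem continuous_wFq {q : ℝ} (hq : q ∈ Set.Icc (0 : ℝ) 4) : Continuous (wFq (n := n) hq) :=
  (mulL _ _).continuous.comp continuous_fourier_L2

/-- The test function whose Fourier transform is paired with solutions. -/
def wTest (ψ : Test n) : Test n := SchwartzMap.smulLeftCLM ℂ (fun ξ => ((weight ξ : ℝ) : ℂ)) ψ

theorem wTest_apply (ψ : Test n) (ξ : Freq n) : wTest ψ ξ = (weight ξ : ℂ) * ψ ξ := by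
  rw [wTest, SchwartzMap.smulLeftCLM_apply_apply hasTemperateGrowth_weight, smul_eq_mul]

theorem coe_apply_fourier_wTest (f : L2 n) (ψ : Test n) :
    (f : Distr n) (𝓕 (wTest ψ)) = (wF f : Distr n) ψ := by
  rw [coe_apply_fourier, wTest, mulL_coe_apply memLp_weight hasTemperateGrowth_weight]
  rfl

theorem coe_apply_fourier_sq_wTest (f : L2 n) (ψ : Test n) :
    (f : Distr n) (𝓕 (SchwartzMap.smulLeftCLM ℂ (fun ξ => ((freq ξ ^ 2 : ℝ) : ℂ)) (wTest ψ))) =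
      (wF2 f : Distr n) ψ := by
  rw [coe_apply_fourier, Lp.toTemperedDistribution_apply, Lp.toTemperedDistribution_apply]
  refine integral_congr_ae ?_
  filter_upwards [coeFn_mulL _ memLp_weight_mul_sq (𝓕 f)] with ξ hξ
  rw [wF2, hξ, SchwartzMap.smulLeftCLM_apply_apply hasTemperateGrowth_freq_sq, wTest_apply]
  simp only [smul_eq_mul]
  push_cast
  ring

theorem laplacian_coe_apply_fourier_wTest (f : L2 n) (ψ : Test n) :
    (Δ (f : Distr n)) (𝓕 (wTest ψ)) = -(wF2 f : Distr n) ψ := by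
  rw [laplacian_apply_fourier, coe_apply_fourier_sq_wTest]

theorem fracLaplacian_fourier_wTest {σ : ℝ} (hσ : 2 * σ ∈ Set.Icc (0 : ℝ) 4) (f : L2 n)
    (ψ : Test n) :
    fracLaplacian σ f (𝓕 (wTest ψ)) = (wFq hσ f : Distr n) ψ := by
  rw [fracLaplacian, Lp.toTemperedDistribution_apply, FourierTransform.fourierInv_fourier_eq]
  refine integral_congr_ae ?_
  filter_upwards [coeFn_mulL _ (memLp_weight_mul_rpow hσ) (𝓕 f)] with ξ hξ
  rw [wFq, hξ, wTest_apply]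
  simp only [smul_eq_mul]
  push_cast
  ring

section Solution

variable {σ : ℝ} {u₀ : Distr n} {u₁ θ₀ : L2 n} {u : ℝ → Distr n} {p v θ : ℝ → L2 n}

/-- Since u is only a distribution, the symbol |ξ|² of -Δ is moved onto the test function in u_t =
v; its smoothness permits this. -/
theorem IsSolution.hasDeriv_wF_p (h : IsSolution σ u₀ u₁ θ₀ u p v θ) {t : ℝ} (ht : 0 ≤ t) :
    HasDerivWithinAt (fun τ => wF (p τ)) (wF2 (v t)) (Set.Ici 0) t := by
  refine hasDerivWithinAt_of_weak (g := fun t => wF2 (v t))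
    (continuous_wF2.comp_continuousOn h.continuousOn_v) (fun ψ t ht => ?_) ht
  have h1 := h.hasDeriv_u
    (𝓕 (SchwartzMap.smulLeftCLM ℂ (fun ξ => ((freq ξ ^ 2 : ℝ) : ℂ)) (wTest ψ))) t ht
  rw [coe_apply_fourier_sq_wTest] at h1
  refine h1.congr_of_mem (fun τ hτ => ?_) ht
  rw [← coe_apply_fourier_wTest, ← h.neg_laplacian_u τ hτ]
  change -((Δ (u τ)) (𝓕 (wTest ψ))) = _
  rw [laplacian_apply_fourier, neg_neg]

theorem IsSolution.hasDeriv_wF_v (h : IsSolution σ u₀ u₁ θ₀ u p v θ)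
    (hσ : 2 * σ ∈ Set.Icc (0 : ℝ) 4) {t : ℝ} (ht : 0 ≤ t) :
    HasDerivWithinAt (fun τ => wF (v τ)) (wF2 (θ t) - wF2 (p t) - wFq hσ (v t)) (Set.Ici 0) t := by
  refine hasDerivWithinAt_of_weak (g := fun t => wF2 (θ t) - wF2 (p t) - wFq hσ (v t))
    (((continuous_wF2.comp_continuousOn h.continuousOn_θ).sub
      (continuous_wF2.comp_continuousOn h.continuousOn_p)).sub
      ((continuous_wFq hσ).comp_continuousOn h.continuousOn_v)) (fun ψ t ht => ?_) ht
  have h1 := h.hasDeriv_v (𝓕 (wTest ψ)) t ht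
  -- Δ²u = -Δp, so the plate term acts on p with the symbol |ξ|² only.
  have h2 : (Δ (Δ (u t))) (𝓕 (wTest ψ)) = (wF2 (p t) : Distr n) ψ := by
    rw [TemperedDistribution.laplacian_apply_apply, ← neg_neg (Δ (u t)), h.neg_laplacian_u t ht]
    change -((p t : Distr n) _) = _
    rw [← TemperedDistribution.laplacian_apply_apply, laplacian_coe_apply_fourier_wTest, neg_neg]
  rw [h2, laplacian_coe_apply_fourier_wTest, fracLaplacian_fourier_wTest hσ] at h1
  have h3 : ((wF2 (θ t) - wF2 (p t) - wFq hσ (v t) : L2 n) : Distr n) ψ =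
      (wF2 (θ t) : Distr n) ψ - (wF2 (p t) : Distr n) ψ - (wFq hσ (v t) : Distr n) ψ := by
    simp only [← Lp.toTemperedDistributionCLM_apply, map_sub]
    rfl
  refine (h1.congr_of_mem (fun τ hτ => ?_) ht).congr_deriv ?_
  · exact (coe_apply_fourier_wTest _ _).symm
  · rw [h3]; ring

theorem IsSolution.hasDeriv_wF_θ (h : IsSolution σ u₀ u₁ θ₀ u p v θ) {t : ℝ} (ht : 0 ≤ t) :
    HasDerivWithinAt (fun τ => wF (θ τ)) (-wF2 (θ t) - wF2 (v t)) (Set.Ici 0) t := by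
  refine hasDerivWithinAt_of_weak (g := fun t => -wF2 (θ t) - wF2 (v t))
    ((continuous_wF2.comp_continuousOn h.continuousOn_θ).neg.sub
      (continuous_wF2.comp_continuousOn h.continuousOn_v)) (fun ψ t ht => ?_) ht
  have h1 := h.hasDeriv_θ (𝓕 (wTest ψ)) t ht
  rw [laplacian_coe_apply_fourier_wTest, laplacian_coe_apply_fourier_wTest] at h1
  have h3 : ((-wF2 (θ t) - wF2 (v t) : L2 n) : Distr n) ψ =
      -(wF2 (θ t) : Distr n) ψ - (wF2 (v t) : Distr n) ψ := by
    simp only [← Lp.toTemperedDistributionCLM_apply, map_sub, map_neg]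
    rfl
  refine (h1.congr_of_mem (fun τ hτ => ?_) ht).congr_deriv ?_
  · exact (coe_apply_fourier_wTest _ _).symm
  · rw [h3]; ring

end Solution

end WeightedEquations

/-! ### The Lyapunov function at a fixed frequency. -/

section LyapunovFunction

/-- The energy part equals -2bv² - 2aθ². The vθ term contributes -kav²/8 and the pv term -kap²/32;
the latter also produces +kav²/32, so its coefficient must be the smaller one. The remaining cross
terms are absorbed by Young's inequality: three of them cost kap²/128 each, leaving exactly kap²/128
of damping in p. -/
theorem quadratic_dissipation {a b k : ℝ} (ha : 0 ≤ a) (hb : 0 ≤ b) (hk : 0 ≤ k) (hk1 : k ≤ 1)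
    (hkb : k * b ≤ a) (p v θ : ℝ) :
    2 * (p * (a * v)) + 2 * (v * (a * θ - a * p - b * v)) + 2 * (θ * (-(a * θ) - a * v)) +
      1 / 8 * (k * ((a * θ - a * p - b * v) * θ + v * (-(a * θ) - a * v))) +
      1 / 32 * (k * (a * v * v + p * (a * θ - a * p - b * v))) ≤
    -(1 / 128) * (k * a) * (p ^ 2 + v ^ 2 + θ ^ 2) := by
  have hX : 0 ≤ k * a := mul_nonneg hk ha
  have hXa : k * a ≤ a := mul_le_of_le_one_left ha hk1
  have hy : 0 ≤ k * b := mul_nonneg hk hb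
  have hyb : k * b ≤ b := mul_le_of_le_one_left hb hk1
  have h1 := mul_nonneg hX (sq_nonneg (p + 8 * θ))
  have h2 : k * b * -(2 * v * θ) ≤ b * v ^ 2 + a * θ ^ 2 := by
    nlinarith [mul_nonneg hy (sq_nonneg (v + θ)), mul_le_mul_of_nonneg_right hyb (sq_nonneg v),
      mul_le_mul_of_nonneg_right hkb (sq_nonneg θ)]
  have h3 := mul_nonneg hX (sq_nonneg (v + 2 * θ))
  have h4 : -(2 * (k * b) * (v * p)) ≤ k * a * p ^ 2 / 2 + 2 * (b * v ^ 2) := by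
    nlinarith [mul_nonneg hb (sq_nonneg (2 * v + k * p)),
      mul_le_mul_of_nonneg_left hkb (mul_nonneg hk (sq_nonneg p))]
  have h5 := mul_nonneg hX (sq_nonneg (p - 2 * θ))
  have h6 := mul_le_mul_of_nonneg_right hXa (sq_nonneg θ)
  have h7 := mul_nonneg hX (sq_nonneg v)
  have h8 := mul_nonneg hb (sq_nonneg v)
  have h9 := mul_nonneg hX (sq_nonneg p)
  have h10 := mul_nonneg hX (sq_nonneg θ)
  have h11 := mul_nonneg ha (sq_nonneg θ)
  nlinarith

open scoped RealInnerProductSpace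

/-- The Lyapunov function of the linear system at a fixed frequency. -/
def lyap (k : ℝ) (p v θ : ℂ) : ℝ :=
  ⟪p, p⟫ + ⟪v, v⟫ + ⟪θ, θ⟫ + 1 / 8 * (k * ⟪v, θ⟫) + 1 / 32 * (k * ⟪p, v⟫)

theorem complex_real_inner (z w : ℂ) : ⟪z, w⟫ = z.re * w.re + z.im * w.im := by
  rw [Complex.inner, Complex.mul_re]; simp; ring

theorem lyap_le {k : ℝ} (hk : 0 ≤ k) (hk1 : k ≤ 1) (p v θ : ℂ) :
    lyap k p v θ ≤ 2 * (‖p‖ ^ 2 + ‖v‖ ^ 2 + ‖θ‖ ^ 2) := by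
  have h1 := abs_le.1 (abs_real_inner_le_norm v θ)
  have h2 := abs_le.1 (abs_real_inner_le_norm p v)
  have h3 : k * ⟪v, θ⟫ ≤ ‖v‖ * ‖θ‖ := by
    nlinarith [mul_nonneg (norm_nonneg v) (norm_nonneg θ)]
  have h4 : k * ⟪p, v⟫ ≤ ‖p‖ * ‖v‖ := by
    nlinarith [mul_nonneg (norm_nonneg p) (norm_nonneg v)]
  simp only [lyap, real_inner_self_eq_norm_sq]
  nlinarith [sq_nonneg (‖v‖ - ‖θ‖), sq_nonneg (‖v‖ - ‖p‖), sq_nonneg ‖v‖, sq_nonneg ‖p‖,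
    sq_nonneg ‖θ‖]

theorem le_lyap {k : ℝ} (hk : 0 ≤ k) (hk1 : k ≤ 1) (p v θ : ℂ) :
    1 / 2 * (‖p‖ ^ 2 + ‖v‖ ^ 2 + ‖θ‖ ^ 2) ≤ lyap k p v θ := by
  have h1 := abs_le.1 (abs_real_inner_le_norm v θ)
  have h2 := abs_le.1 (abs_real_inner_le_norm p v)
  have h3 : -(‖v‖ * ‖θ‖) ≤ k * ⟪v, θ⟫ := by
    nlinarith [mul_nonneg (norm_nonneg v) (norm_nonneg θ)]
  have h4 : -(‖p‖ * ‖v‖) ≤ k * ⟪p, v⟫ := by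
    nlinarith [mul_nonneg (norm_nonneg p) (norm_nonneg v)]
  simp only [lyap, real_inner_self_eq_norm_sq]
  nlinarith [sq_nonneg (‖v‖ - ‖θ‖), sq_nonneg (‖v‖ - ‖p‖), sq_nonneg ‖v‖, sq_nonneg ‖p‖,
    sq_nonneg ‖θ‖]

/-- The coefficients are real, so the quadratic inequality applies separately to real and imaginary
parts. The constant 256 is 128 times the factor 2 of `lyap_le`. -/
theorem lyap_dissipation {a b k κ : ℝ} (ha : 0 ≤ a) (hb : 0 ≤ b) (hk : 0 ≤ k) (hk1 : k ≤ 1)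
    (hkb : k * b ≤ a) (hκ : 0 ≤ κ) (hκa : κ ≤ k * a) {p v θ p' v' θ' : ℂ} (hp : p' = a * v)
    (hv : v' = a * θ - a * p - b * v) (hθ : θ' = -(a * θ) - a * v) :
    2 * ⟪p, p'⟫ + 2 * ⟪v, v'⟫ + 2 * ⟪θ, θ'⟫ + 1 / 8 * (k * (⟪v', θ⟫ + ⟪v, θ'⟫)) +
      1 / 32 * (k * (⟪p', v⟫ + ⟪p, v'⟫)) + κ / 256 * lyap k p v θ ≤ 0 := by
  have h1 := quadratic_dissipation ha hb hk hk1 hkb p.re v.re θ.re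
  have h2 := quadratic_dissipation ha hb hk hk1 hkb p.im v.im θ.im
  have h3 := mul_le_mul_of_nonneg_left (lyap_le hk hk1 p v θ) (by positivity : 0 ≤ κ / 256)
  have h4 : κ * (‖p‖ ^ 2 + ‖v‖ ^ 2 + ‖θ‖ ^ 2) ≤ k * a * (‖p‖ ^ 2 + ‖v‖ ^ 2 + ‖θ‖ ^ 2) :=
    mul_le_mul_of_nonneg_right hκa (by positivity)
  have e : ∀ z : ℂ, ‖z‖ ^ 2 = z.re ^ 2 + z.im ^ 2 := fun z => by
    rw [Complex.sq_norm, Complex.normSq_apply]; ring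
  subst hp hv hθ
  simp only [e] at h3 h4
  simp only [complex_real_inner, Complex.sub_re, Complex.sub_im, Complex.neg_re, Complex.neg_im,
    Complex.re_ofReal_mul, Complex.im_ofReal_mul]
  linarith

end LyapunovFunction

/-! ### Pointwise exponential decay in frequency. -/

section EnergyEstimate

open scoped RealInnerProductSpace

variable {n : ℕ}

/-- `f` is integrable with integral `I`. -/
def HasIntegral (f : Freq n → ℝ) (I : ℝ) : Prop := Integrable f volume ∧ ∫ ξ, f ξ = I

theorem HasIntegral.add {f g : Freq n → ℝ} {I J : ℝ} (hf : HasIntegral f I)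
    (hg : HasIntegral g J) : HasIntegral (fun ξ => f ξ + g ξ) (I + J) :=
  ⟨hf.1.add hg.1, by rw [integral_add hf.1 hg.1, hf.2, hg.2]⟩

theorem HasIntegral.const_mul {f : Freq n → ℝ} {I : ℝ} (hf : HasIntegral f I) (c : ℝ) :
    HasIntegral (fun ξ => c * f ξ) (c * I) :=
  ⟨hf.1.const_mul c, by rw [integral_const_mul, hf.2]⟩

theorem HasIntegral.nonpos {f : Freq n → ℝ} {I : ℝ} (hf : HasIntegral f I)
    (h : ∀ᵐ ξ, f ξ ≤ 0) : I ≤ 0 :=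
  hf.2 ▸ integral_nonpos_of_ae h

/-- The weighted `L²` pairing. -/
def pair (l : Freq n → ℝ) (hl : MemLp l ∞ volume) (f g : L2 n) : ℝ := ⟪f, mulL l hl g⟫

theorem hasIntegral_pair (l : Freq n → ℝ) (hl : MemLp l ∞ volume) (f g : L2 n) :
    HasIntegral (fun ξ => l ξ * ⟪f ξ, g ξ⟫) (pair l hl f g) := by
  have e : (fun ξ => ⟪f ξ, (mulL l hl g) ξ⟫) =ᵐ[volume] fun ξ => l ξ * ⟪f ξ, g ξ⟫ := by
    filter_upwards [coeFn_mulL l hl g] with ξ hξ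
    rw [hξ, ← Complex.real_smul, real_inner_smul_right]
  exact ⟨(L2.integrable_inner f (mulL l hl g)).congr e, by
    rw [pair, L2.inner_def]; exact (integral_congr_ae e).symm⟩

theorem hasDerivWithinAt_pair (l : Freq n → ℝ) (hl : MemLp l ∞ volume) {f g : ℝ → L2 n}
    {f' g' : L2 n} {s : Set ℝ} {t : ℝ} (hf : HasDerivWithinAt f f' s t)
    (hg : HasDerivWithinAt g g' s t) :
    HasDerivWithinAt (fun τ => pair l hl (f τ) (g τ)) (pair l hl f' (g t) + pair l hl (f t) g')
      s t := by
  have h := hf.inner ℝ ((mulL l hl).hasFDerivAt.comp_hasDerivWithinAt t hg)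
  rw [add_comm]
  exact h

/-- The ratio of the symbols which balances the Lyapunov function. -/
def ratio (σ : ℝ) (ξ : Freq n) : ℝ := freq ξ ^ 2 / max (freq ξ ^ 2) (freq ξ ^ (2 * σ))

/-- The exponential rate of decay at the frequency `ξ`. -/
def rate (σ : ℝ) (ξ : Freq n) : ℝ := ratio σ ξ * freq ξ ^ 2

theorem ratio_nonneg (σ : ℝ) (ξ : Freq n) : 0 ≤ ratio σ ξ :=
  div_nonneg (sq_nonneg _) (le_max_of_le_left (sq_nonneg _))

theorem ratio_le_one (σ : ℝ) (ξ : Freq n) : ratio σ ξ ≤ 1 :=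
  div_le_one_of_le₀ (le_max_left _ _) (le_max_of_le_left (sq_nonneg _))

/-- The denominator may vanish at ξ = 0; division by zero then makes `ratio` zero and the bound
survives. -/
theorem ratio_mul_le (σ : ℝ) (ξ : Freq n) : ratio σ ξ * freq ξ ^ (2 * σ) ≤ freq ξ ^ 2 := by
  rw [ratio, div_mul_eq_mul_div]
  exact div_le_of_le_mul₀ (le_max_of_le_left (sq_nonneg _)) (sq_nonneg _)
    (mul_le_mul_of_nonneg_left (le_max_right _ _) (sq_nonneg _))

theorem measurable_ratio (σ : ℝ) : Measurable (ratio (n := n) σ) :=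
  (continuous_freq.measurable.pow_const 2).div
    ((continuous_freq.measurable.pow_const 2).max (measurable_freq_rpow _))

theorem measurable_rate (σ : ℝ) : Measurable (rate (n := n) σ) :=
  (measurable_ratio σ).mul (continuous_freq.measurable.pow_const 2)

theorem rate_nonneg (σ : ℝ) (ξ : Freq n) : 0 ≤ rate σ ξ :=
  mul_nonneg (ratio_nonneg σ ξ) (sq_nonneg _)

theorem memLp_indicator_one {B : Set (Freq n)} (hB : MeasurableSet B) :
    MemLp (B.indicator fun _ => (1 : ℝ)) ∞ volume :=
  memLp_top_of_bound (measurable_const.indicator hB).aestronglyMeasurable 1 <|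
    .of_forall fun ξ => by by_cases h : ξ ∈ B <;> simp [h]

theorem memLp_indicator_ratio {B : Set (Freq n)} (hB : MeasurableSet B) (σ : ℝ) :
    MemLp (B.indicator (ratio σ)) ∞ volume :=
  memLp_top_of_bound ((measurable_ratio σ).indicator hB).aestronglyMeasurable 1 <|
    .of_forall fun ξ => by
      by_cases h : ξ ∈ B <;> simp [h, abs_of_nonneg (ratio_nonneg σ ξ), ratio_le_one σ ξ]

/-- The Lyapunov functional restricted to the frequencies in `B`. -/
def lyapOn (σ : ℝ) {B : Set (Freq n)} (hB : MeasurableSet B) (p v θ : L2 n) : ℝ :=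
  pair _ (memLp_indicator_one hB) p p + pair _ (memLp_indicator_one hB) v v +
    pair _ (memLp_indicator_one hB) θ θ + 1 / 8 * pair _ (memLp_indicator_ratio hB σ) v θ +
    1 / 32 * pair _ (memLp_indicator_ratio hB σ) p v

theorem hasIntegral_lyapOn (σ : ℝ) {B : Set (Freq n)} (hB : MeasurableSet B) (p v θ : L2 n) :
    HasIntegral (B.indicator fun ξ => lyap (ratio σ ξ) (p ξ) (v ξ) (θ ξ))
      (lyapOn σ hB p v θ) := by
  have h := ((((hasIntegral_pair _ (memLp_indicator_one hB) p p).add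
    (hasIntegral_pair _ (memLp_indicator_one hB) v v)).add
    (hasIntegral_pair _ (memLp_indicator_one hB) θ θ)).add
    ((hasIntegral_pair _ (memLp_indicator_ratio hB σ) v θ).const_mul (1 / 8))).add
    ((hasIntegral_pair _ (memLp_indicator_ratio hB σ) p v).const_mul (1 / 32))
  convert h using 1
  · ext ξ
    by_cases hξ : ξ ∈ B <;> simp [hξ, lyap]
  · rfl

section Solution

variable {σ : ℝ} {u₀ : Distr n} {u₁ θ₀ : L2 n} {u : ℝ → Distr n} {p v θ : ℝ → L2 n}

theorem coeFn_wF2 (f : L2 n) : wF2 f =ᵐ[volume] fun ξ => ((freq ξ ^ 2 : ℝ) : ℂ) * wF f ξ := by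
  filter_upwards [coeFn_mulL _ memLp_weight_mul_sq (𝓕 f), coeFn_mulL _ memLp_weight (𝓕 f)]
    with ξ h1 h2
  rw [wF2, wF, h1, h2]
  push_cast
  ring

theorem coeFn_wFq {q : ℝ} (hq : q ∈ Set.Icc (0 : ℝ) 4) (f : L2 n) :
    wFq hq f =ᵐ[volume] fun ξ => ((freq ξ ^ q : ℝ) : ℂ) * wF f ξ := by
  filter_upwards [coeFn_mulL _ (memLp_weight_mul_rpow hq) (𝓕 f), coeFn_mulL _ memLp_weight (𝓕 f)]
    with ξ h1 h2
  rw [wFq, wF, h1, h2]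
  push_cast
  ring

theorem IsSolution.exists_hasDeriv_lyapOn (h : IsSolution σ u₀ u₁ θ₀ u p v θ)
    (hσ : 2 * σ ∈ Set.Icc (0 : ℝ) 4) {B : Set (Freq n)} (hB : MeasurableSet B) {κ : ℝ}
    (hκ : 0 ≤ κ) (hκB : ∀ ξ ∈ B, κ ≤ rate σ ξ) {t : ℝ} (ht : 0 ≤ t) :
    ∃ d, HasDerivWithinAt (fun τ => lyapOn σ hB (wF (p τ)) (wF (v τ)) (wF (θ τ))) d
      (Set.Ici 0) t ∧ d + κ / 256 * lyapOn σ hB (wF (p t)) (wF (v t)) (wF (θ t)) ≤ 0 := by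
  have hp := h.hasDeriv_wF_p ht
  have hv := h.hasDeriv_wF_v hσ ht
  have hθ := h.hasDeriv_wF_θ ht
  have l0 := memLp_indicator_one hB
  have l1 := memLp_indicator_ratio hB σ
  refine ⟨_, ((((hasDerivWithinAt_pair _ l0 hp hp).add (hasDerivWithinAt_pair _ l0 hv hv)).add
    (hasDerivWithinAt_pair _ l0 hθ hθ)).add
    ((hasDerivWithinAt_pair _ l1 hv hθ).const_mul (1 / 8))).add
    ((hasDerivWithinAt_pair _ l1 hp hv).const_mul (1 / 32)), ?_⟩
  -- The derivative plus κ/256 times the functional is a single integral; its integrand is the left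
  -- side of `lyap_dissipation` on B and zero off B.
  refine HasIntegral.nonpos (((((((hasIntegral_pair _ _ _ _).add (hasIntegral_pair _ _ _ _)).add
    ((hasIntegral_pair _ _ _ _).add (hasIntegral_pair _ _ _ _))).add
    ((hasIntegral_pair _ _ _ _).add (hasIntegral_pair _ _ _ _))).add
    (((hasIntegral_pair _ _ _ _).add (hasIntegral_pair _ _ _ _)).const_mul (1 / 8))).add
    (((hasIntegral_pair _ _ _ _).add (hasIntegral_pair _ _ _ _)).const_mul (1 / 32))).add
    ((hasIntegral_lyapOn σ hB _ _ _).const_mul (κ / 256))) ?_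
  filter_upwards [coeFn_wF2 (p t), coeFn_wF2 (v t), coeFn_wF2 (θ t), coeFn_wFq hσ (v t),
    Lp.coeFn_sub (wF2 (θ t) - wF2 (p t)) (wFq hσ (v t)), Lp.coeFn_sub (wF2 (θ t)) (wF2 (p t)),
    Lp.coeFn_sub (-wF2 (θ t)) (wF2 (v t)), Lp.coeFn_neg (wF2 (θ t))] with ξ e1 e2 e3 e4 e5 e6 e7 e8
  by_cases hξ : ξ ∈ B
  · have := lyap_dissipation (sq_nonneg (freq ξ)) (Real.rpow_nonneg (freq_nonneg ξ) (2 * σ))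
      (ratio_nonneg σ ξ) (ratio_le_one σ ξ) (ratio_mul_le σ ξ) hκ (hκB ξ hξ)
      (p := wF (p t) ξ) (v := wF (v t) ξ) (θ := wF (θ t) ξ) (p' := wF2 (v t) ξ)
      (v' := (wF2 (θ t) - wF2 (p t) - wFq hσ (v t) : L2 n) ξ)
      (θ' := (-wF2 (θ t) - wF2 (v t) : L2 n) ξ) e2
      (by rw [e5, Pi.sub_apply, e6, Pi.sub_apply, e1, e3, e4])
      (by rw [e7, Pi.sub_apply, e8, Pi.neg_apply, e2, e3])
    simp only [hξ, Set.indicator_of_mem, one_mul]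
    rw [real_inner_comm (wF (p t) ξ) (wF2 (v t) ξ), real_inner_comm (wF (v t) ξ) _,
      real_inner_comm (wF (θ t) ξ) _]
    simp only [real_inner_comm] at this ⊢
    linarith
  · simp [hξ]

theorem IsSolution.lyapOn_le (h : IsSolution σ u₀ u₁ θ₀ u p v θ)
    (hσ : 2 * σ ∈ Set.Icc (0 : ℝ) 4) {B : Set (Freq n)} (hB : MeasurableSet B) {κ : ℝ}
    (hκ : 0 ≤ κ) (hκB : ∀ ξ ∈ B, κ ≤ rate σ ξ) {t : ℝ} (ht : 0 ≤ t) :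
    lyapOn σ hB (wF (p t)) (wF (v t)) (wF (θ t)) ≤
      Real.exp (-(κ / 256 * t)) * lyapOn σ hB (wF (p 0)) (wF (v 0)) (wF (θ 0)) := by
  set Φ : ℝ → ℝ := fun τ => lyapOn σ hB (wF (p τ)) (wF (v τ)) (wF (θ τ)) with hΦ
  choose! d hd hd' using fun τ (hτ : 0 ≤ τ) => h.exists_hasDeriv_lyapOn hσ hB hκ hκB hτ
  have hD : ∀ τ, 0 ≤ τ → HasDerivWithinAt (fun τ => Real.exp (κ / 256 * τ) * Φ τ)
      (Real.exp (κ / 256 * τ) * (κ / 256) * Φ τ + Real.exp (κ / 256 * τ) * d τ)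
      (Set.Ici 0) τ := fun τ hτ => by
    have h1 : HasDerivAt (fun τ => Real.exp (κ / 256 * τ))
        (Real.exp (κ / 256 * τ) * (κ / 256)) τ := by
      simpa using ((hasDerivAt_id τ).const_mul (κ / 256)).exp
    exact h1.hasDerivWithinAt.mul (hd τ hτ)
  have hanti : AntitoneOn (fun τ => Real.exp (κ / 256 * τ) * Φ τ) (Set.Ici 0) := by
    refine antitoneOn_of_hasDerivWithinAt_nonpos (convex_Ici 0)
      (fun τ hτ => (hD τ hτ).continuousWithinAt) (fun τ hτ => (hD τ ?_).mono interior_subset)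
      (fun τ hτ => ?_)
    · exact interior_subset hτ
    · have := hd' τ (interior_subset hτ)
      have := mul_nonpos_of_nonneg_of_nonpos (Real.exp_pos (κ / 256 * τ)).le this
      linarith
  have := hanti Set.self_mem_Ici ht ht
  simp only [mul_zero, Real.exp_zero, one_mul] at this
  rw [Real.exp_neg, inv_mul_eq_div, le_div_iff₀' (Real.exp_pos _)]
  exact this

/-- The integrated bound holds on every measurable subset of {κ ≤ rate}, so the integrands compare
almost everywhere there. -/
theorem IsSolution.ae_lyap_le (h : IsSolution σ u₀ u₁ θ₀ u p v θ)
    (hσ : 2 * σ ∈ Set.Icc (0 : ℝ) 4) {κ : ℝ} (hκ : 0 ≤ κ) {t : ℝ} (ht : 0 ≤ t) :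
    ∀ᵐ ξ, κ ≤ rate σ ξ → lyap (ratio σ ξ) (wF (p t) ξ) (wF (v t) ξ) (wF (θ t) ξ) ≤
      Real.exp (-(κ / 256 * t)) *
        lyap (ratio σ ξ) (wF (p 0) ξ) (wF (v 0) ξ) (wF (θ 0) ξ) := by
  have hD : MeasurableSet {ξ : Freq n | κ ≤ rate σ ξ} :=
    measurableSet_le measurable_const (measurable_rate σ)
  have hint : ∀ τ, Integrable
      (fun ξ => lyap (ratio σ ξ) (wF (p τ) ξ) (wF (v τ) ξ) (wF (θ τ) ξ)) := fun τ => by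
    simpa using (hasIntegral_lyapOn σ MeasurableSet.univ (wF (p τ)) (wF (v τ)) (wF (θ τ))).1
  refine (ae_restrict_iff' hD).1 ?_
  refine ae_le_of_forall_setIntegral_le (hint t).integrableOn
    ((hint 0).integrableOn.const_mul _) fun s hs _ => ?_
  have hB := hs.inter hD
  have := h.lyapOn_le hσ hB hκ (fun ξ hξ => hξ.2) ht
  rw [← (hasIntegral_lyapOn σ hB _ _ _).2, ← (hasIntegral_lyapOn σ hB _ _ _).2,
    integral_indicator hB, integral_indicator hB] at this
  rw [Measure.restrict_restrict hs, integral_const_mul]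
  exact this

theorem IsSolution.ae_norm_fourier_le (h : IsSolution σ u₀ u₁ θ₀ u p v θ)
    (hσ : 2 * σ ∈ Set.Icc (0 : ℝ) 4) {t : ℝ} (ht : 0 ≤ t) :
    ∀ᵐ ξ, ‖(𝓕 (p t) : L2 n) ξ‖ ^ 2 + ‖(𝓕 (v t) : L2 n) ξ‖ ^ 2 + ‖(𝓕 (θ t) : L2 n) ξ‖ ^ 2 ≤
      4 * Real.exp (-(rate σ ξ / 512 * t)) * (‖(𝓕 (p 0) : L2 n) ξ‖ ^ 2 +
        ‖(𝓕 (v 0) : L2 n) ξ‖ ^ 2 + ‖(𝓕 (θ 0) : L2 n) ξ‖ ^ 2) := by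
  -- The exceptional null set depends on κ. Countably many rational κ share one null set, and a
  -- rational between rate/2 and rate can then be chosen at each ξ; this turns 256 into 512.
  have hall : ∀ᵐ ξ, ∀ q : ℚ, 0 ≤ (q : ℝ) → (q : ℝ) ≤ rate σ ξ →
      lyap (ratio σ ξ) (wF (p t) ξ) (wF (v t) ξ) (wF (θ t) ξ) ≤
      Real.exp (-((q : ℝ) / 256 * t)) *
        lyap (ratio σ ξ) (wF (p 0) ξ) (wF (v 0) ξ) (wF (θ 0) ξ) := by
    refine ae_all_iff.2 fun q => ?_
    by_cases hq : 0 ≤ (q : ℝ)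
    · filter_upwards [h.ae_lyap_le hσ hq ht] with ξ hξ _ using hξ
    · exact .of_forall fun ξ h0 => absurd h0 hq
  have hw : ∀ f : L2 n, ∀ᵐ ξ, ‖wF f ξ‖ ^ 2 = weight ξ ^ 2 * ‖(𝓕 f : L2 n) ξ‖ ^ 2 := fun f => by
    filter_upwards [coeFn_mulL _ memLp_weight (𝓕 f)] with ξ hξ
    rw [wF, hξ, norm_mul, mul_pow, Complex.norm_real, Real.norm_eq_abs, sq_abs]
  filter_upwards [hall, hw (p t), hw (v t), hw (θ t), hw (p 0), hw (v 0), hw (θ 0)]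
    with ξ hξ e1 e2 e3 e4 e5 e6
  obtain ⟨q, hq0, hq1, hq2⟩ : ∃ q : ℚ, 0 ≤ (q : ℝ) ∧ (q : ℝ) ≤ rate σ ξ ∧
      rate σ ξ / 2 ≤ q := by
    rcases (rate_nonneg σ ξ).eq_or_lt with h0 | h0
    · exact ⟨0, by simp, by simp [← h0], by simp [← h0]⟩
    · obtain ⟨q, hq, hq'⟩ := exists_rat_btwn (half_lt_self h0)
      exact ⟨q, by linarith, hq'.le, hq.le⟩
  have h1 := hξ q hq0 hq1
  have h2 := le_lyap (ratio_nonneg σ ξ) (ratio_le_one σ ξ) (wF (p t) ξ) (wF (v t) ξ) (wF (θ t) ξ)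
  have h3 := lyap_le (ratio_nonneg σ ξ) (ratio_le_one σ ξ) (wF (p 0) ξ) (wF (v 0) ξ) (wF (θ 0) ξ)
  rw [e1, e2, e3, ← mul_add, ← mul_add] at h2
  rw [e4, e5, e6, ← mul_add, ← mul_add] at h3
  have h4 : Real.exp (-((q : ℝ) / 256 * t)) ≤ Real.exp (-(rate σ ξ / 512 * t)) :=
    Real.exp_le_exp.2 (by nlinarith)
  have h5 := h1.trans (mul_le_mul_of_nonneg_left h3 (Real.exp_pos _).le)
  set S := ‖(𝓕 (p 0) : L2 n) ξ‖ ^ 2 + ‖(𝓕 (v 0) : L2 n) ξ‖ ^ 2 + ‖(𝓕 (θ 0) : L2 n) ξ‖ ^ 2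
  have hS : 0 ≤ S := by positivity
  have hw2 : 0 < weight ξ ^ 2 := pow_pos (weight_pos ξ) 2
  have h6 := mul_le_mul_of_nonneg_right h4 (by positivity : 0 ≤ 2 * (weight ξ ^ 2 * S))
  refine le_of_mul_le_mul_left ?_ hw2
  linarith

end Solution

end EnergyEstimate

/-! ### An Lᵐ–L² bound for Fourier multipliers. -/

section HausdorffYoung

variable {n : ℕ}

/-- Both sides have the same integral against every smooth compactly supported function, by
self-adjointness of the Fourier integral. -/
theorem coeFn_fourierInv_of_integrable (h : L2 n) (hint : Integrable h volume) :
    ∀ᵐ x, (𝓕⁻ h : L2 n) x = ∫ ξ, Real.fourierChar (inner ℝ ξ x) • h ξ := by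
  -- The sign turns the general Fourier integral into the inverse transform.
  set L : Freq n →ₗ[ℝ] Freq n →ₗ[ℝ] ℝ := -innerₗ (Freq n) with hL
  have hLc : Continuous fun p : Freq n × Freq n => L p.1 p.2 := by
    simp only [hL, LinearMap.neg_apply, innerₗ_apply_apply]
    fun_prop
  have hLf : L.flip = L := by
    ext x y
    simp [hL, real_inner_comm]
  have hv : ∀ (f : Freq n → ℂ) x, VectorFourier.fourierIntegral Real.fourierChar volume L f x =
      ∫ ξ, Real.fourierChar (inner ℝ ξ x) • f ξ := fun f x => by
    simp [VectorFourier.fourierIntegral, hL]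
  have hc : Continuous fun x => ∫ ξ, Real.fourierChar (inner ℝ ξ x) • h ξ := by
    simp_rw [← hv]
    exact VectorFourier.fourierIntegral_continuous Real.continuous_fourierChar hLc hint
  refine ae_eq_of_integral_contDiff_smul_eq
    ((Lp.memLp (𝓕⁻ h : L2 n)).locallyIntegrable (by norm_num)) hc.locallyIntegrable ?_
  intro g hg hgs
  have hg₁ : HasCompactSupport (Complex.ofRealCLM ∘ g) := hgs.comp_left rfl
  have hg₂ : ContDiff ℝ ((⊤ : ℕ∞) : WithTop ℕ∞) (Complex.ofRealCLM ∘ g) := by fun_prop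
  set φ : Test n := hg₁.toSchwartzMap hg₂
  have e1 : ∫ x, g x • (𝓕⁻ h : L2 n) x = ((𝓕⁻ h : L2 n) : Distr n) φ := by
    rw [Lp.toTemperedDistribution_apply]
    rfl
  rw [e1, ← Lp.fourierInv_toTemperedDistribution_eq, TemperedDistribution.fourierInv_apply,
    Lp.toTemperedDistribution_apply]
  have e2 := VectorFourier.integral_fourierIntegral_smul_eq_flip (L := L)
    Real.continuous_fourierChar hLc (φ.integrable (μ := volume)) hint
  rw [hLf] at e2
  simp_rw [hv] at e2
  refine Eq.trans (integral_congr_ae (.of_forall fun ξ => ?_)) e2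
  simp only [SchwartzMap.fourierInv_coe, Real.fourierInv_eq]

theorem norm_fourierInv_le_of_integrable (h : L2 n) (hint : Integrable h volume) :
    ∀ᵐ x, ‖(𝓕⁻ h : L2 n) x‖ ≤ ∫ ξ, ‖h ξ‖ := by
  filter_upwards [coeFn_fourierInv_of_integrable h hint] with x hx
  rw [hx]
  refine (norm_integral_le_integral_norm _).trans_eq ?_
  simp

/-- Hölder's inequality, with the dual norm of h interpolated between L² and L^∞ by writing |h| =
|h|^θ |h|^{1-θ}, θ = 2/m'. The case m = 1 is separate because m' is infinite. -/
theorem lintegral_mul_le_of_bounded {α : Type*} [MeasurableSpace α] {μ : Measure α} {f h : α → ℂ}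
    (hf : AEStronglyMeasurable f μ) (hh : AEStronglyMeasurable h μ) {H S : ℝ} (hH : 0 ≤ H)
    (hS : 0 ≤ S) (hbd : ∀ᵐ x ∂μ, ‖h x‖ ≤ H) (h2 : eLpNorm h 2 μ ≤ ENNReal.ofReal S) {m : ℝ}
    (hm : m ∈ Set.Icc (1 : ℝ) 2) :
    ∫⁻ x, ‖f x‖ₑ * ‖h x‖ₑ ∂μ ≤
      eLpNorm f (ENNReal.ofReal m) μ * ENNReal.ofReal (S ^ (2 - 2 / m) * H ^ (2 / m - 1)) := by
  have hm0 : 0 < m := by linarith [hm.1]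
  have hbd' : ∀ᵐ x ∂μ, ‖h x‖ₑ ≤ ENNReal.ofReal H := by
    filter_upwards [hbd] with x hx
    rw [← ofReal_norm]
    exact ENNReal.ofReal_le_ofReal hx
  have hfm : eLpNorm f (ENNReal.ofReal m) μ = (∫⁻ x, ‖f x‖ₑ ^ m ∂μ) ^ (1 / m) := by
    rw [eLpNorm_eq_lintegral_rpow_enorm_toReal (by simpa using hm0) ENNReal.ofReal_ne_top,
      ENNReal.toReal_ofReal hm0.le]
  rcases hm.1.eq_or_lt with rfl | hm1
  · rw [hfm]
    norm_num
    calc ∫⁻ x, ‖f x‖ₑ * ‖h x‖ₑ ∂μ ≤ ∫⁻ x, ‖f x‖ₑ * ENNReal.ofReal H ∂μ :=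
          lintegral_mono_ae (by filter_upwards [hbd'] with x hx; gcongr)
      _ = _ := lintegral_mul_const'' _ hf.enorm
  · set θ : ℝ := 2 - 2 / m with hθ
    have hq := Real.HolderConjugate.conjExponent hm1
    set q := Real.conjExponent m with hqd
    have hqθ : θ * q = 2 := by
      rw [hθ, hqd, Real.conjExponent]
      field_simp [sub_ne_zero.2 hm1.ne']
    have hθ0 : 0 ≤ θ := by
      rw [hθ, sub_nonneg, div_le_iff₀ hm0]
      linarith
    have hθ1 : 0 ≤ 1 - θ := by
      rw [hθ, sub_nonneg, sub_le_comm, le_div_iff₀ hm0]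
      linarith [hm.2]
    have hθe : 2 / m - 1 = 1 - θ := by rw [hθ]; ring
    have hh2 : (∫⁻ x, (‖h x‖ₑ ^ θ) ^ q ∂μ) ^ (1 / q) = eLpNorm h 2 μ ^ θ := by
      rw [eLpNorm_eq_lintegral_rpow_enorm_toReal (by norm_num) (by norm_num), ENNReal.toReal_ofNat,
        ← ENNReal.rpow_mul]
      simp_rw [← ENNReal.rpow_mul, hqθ]
      congr 1
      rw [← hqθ]
      have := hq.symm.pos
      have : θ ≠ 0 := fun h => by simp [h] at hqθ
      field_simp
    calc ∫⁻ x, ‖f x‖ₑ * ‖h x‖ₑ ∂μ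
        ≤ ∫⁻ x, (‖f x‖ₑ * ‖h x‖ₑ ^ θ) * ENNReal.ofReal H ^ (1 - θ) ∂μ := by
          refine lintegral_mono_ae ?_
          filter_upwards [hbd'] with x hx
          have e : ‖h x‖ₑ = ‖h x‖ₑ ^ θ * ‖h x‖ₑ ^ (1 - θ) := by
            rw [← ENNReal.rpow_add_of_nonneg _ _ hθ0 hθ1]
            simp
          rw [mul_assoc]
          conv_lhs => rw [e]
          gcongr
      _ = (∫⁻ x, ‖f x‖ₑ * ‖h x‖ₑ ^ θ ∂μ) * ENNReal.ofReal H ^ (1 - θ) :=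
          lintegral_mul_const'' _ (hf.enorm.mul (hh.enorm.pow_const θ))
      _ ≤ ((∫⁻ x, ‖f x‖ₑ ^ m ∂μ) ^ (1 / m) * (∫⁻ x, (‖h x‖ₑ ^ θ) ^ q ∂μ) ^ (1 / q)) *
            ENNReal.ofReal H ^ (1 - θ) := by
          gcongr
          exact ENNReal.lintegral_mul_le_Lp_mul_Lq μ hq hf.enorm (hh.enorm.pow_const θ)
      _ ≤ (eLpNorm f (ENNReal.ofReal m) μ * ENNReal.ofReal S ^ θ) * ENNReal.ofReal H ^ (1 - θ) := by
          rw [hh2, ← hfm]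
          gcongr
      _ = _ := by
          rw [hθe, ENNReal.ofReal_mul (Real.rpow_nonneg hS _), ENNReal.ofReal_rpow_of_nonneg hS hθ0,
            ENNReal.ofReal_rpow_of_nonneg hH hθ1, mul_assoc]

open scoped ComplexInnerProductSpace

/-- A Hausdorff–Young estimate for Fourier multipliers which are bounded and square-integrable. -/
theorem eLpNorm_mul_fourier_le {e : Freq n → ℝ} (he : Measurable e) (he0 : ∀ ξ, 0 ≤ e ξ) {A B : ℝ}
    (hB0 : 0 ≤ B) (hA : ∀ ξ, e ξ ≤ A) (hB : eLpNorm e 2 volume ≤ ENNReal.ofReal B) {m : ℝ}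
    (hm : m ∈ Set.Icc (1 : ℝ) 2) (f : L2 n) :
    eLpNorm (fun ξ => (e ξ : ℂ) * (𝓕 f : L2 n) ξ) 2 volume ≤
      ENNReal.ofReal (A ^ (2 - 2 / m) * B ^ (2 / m - 1)) * eLpNorm f (ENNReal.ofReal m) volume := by
  have hA0 : 0 ≤ A := (he0 0).trans (hA 0)
  have he' : MemLp e ∞ volume := memLp_top_of_bound he.aestronglyMeasurable A <|
    .of_forall fun ξ => by rw [Real.norm_of_nonneg (he0 ξ)]; exact hA ξ
  -- Duality in TT* form: with g = e·f̂ and h the inverse transform of e·g, ‖g‖² = ⟨f, h⟩.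
  -- Plancherel gives ‖h‖₂ ≤ A‖g‖, Cauchy–Schwarz gives ‖h‖_∞ ≤ B‖g‖, and one factor ‖g‖ cancels at
  -- the end.
  set g : L2 n := mulL e he' (𝓕 f) with hg
  have hgc := coeFn_mulL e he' (𝓕 f)
  set G : L2 n := mulL e he' g with hG
  have hGc := coeFn_mulL e he' g
  have hgN : eLpNorm g 2 volume = ENNReal.ofReal ‖g‖ := by
    rw [Lp.norm_def, ENNReal.ofReal_toReal (Lp.eLpNorm_ne_top g)]
  rw [← eLpNorm_congr_ae hgc, hgN]
  have hGA : ‖G‖ ≤ A * ‖g‖ := by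
    refine Lp.norm_le_mul_norm_of_ae_le_mul ?_
    filter_upwards [hGc] with ξ hξ
    rw [hξ, norm_mul, Complex.norm_real, Real.norm_of_nonneg (he0 ξ)]
    exact mul_le_mul_of_nonneg_right (hA ξ) (norm_nonneg _)
  have hG1 : eLpNorm G 1 volume ≤ ENNReal.ofReal (B * ‖g‖) := by
    have e1 : (G : Freq n → ℂ) =ᵐ[volume] e • (g : Freq n → ℂ) := by
      filter_upwards [hGc] with ξ hξ
      rw [hξ]
      simp
    rw [eLpNorm_congr_ae e1, ENNReal.ofReal_mul hB0, ← hgN]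
    refine (eLpNorm_smul_le_mul_eLpNorm (p := 2) (q := 2) (r := 1) (Lp.aestronglyMeasurable g)
      he.aestronglyMeasurable).trans ?_
    gcongr
  have hGint : Integrable G volume :=
    memLp_one_iff_integrable.1 ⟨Lp.aestronglyMeasurable G, hG1.trans_lt ENNReal.ofReal_lt_top⟩
  have hGi : ∫ ξ, ‖G ξ‖ ≤ B * ‖g‖ := by
    rw [integral_norm_eq_lintegral_enorm hGint.1, ← eLpNorm_one_eq_lintegral_enorm]
    exact ENNReal.toReal_le_of_le_ofReal (by positivity) hG1
  set h : L2 n := 𝓕⁻ G with hh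
  have hFh : (𝓕 h : L2 n) = G := FourierTransform.fourier_fourierInv_eq G
  have hh2 : eLpNorm h 2 volume ≤ ENNReal.ofReal (A * ‖g‖) := by
    have : ‖h‖ = ‖G‖ := by rw [← hFh, Lp.norm_fourier_eq]
    rw [← ENNReal.ofReal_toReal (Lp.eLpNorm_ne_top h), ← Lp.norm_def, this]
    exact ENNReal.ofReal_le_ofReal hGA
  have hhb : ∀ᵐ x, ‖h x‖ ≤ B * ‖g‖ := by
    filter_upwards [norm_fourierInv_le_of_integrable G hGint] with x hx using hx.trans hGi
  have hgg : ⟪g, g⟫ = ⟪f, h⟫ := by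
    rw [← Lp.inner_fourier_eq f h, hFh, L2.inner_def, L2.inner_def]
    refine integral_congr_ae ?_
    filter_upwards [hgc, hGc] with ξ h1 h2
    rw [← hg] at h1
    rw [h2, h1]
    simp only [RCLike.inner_apply, map_mul, Complex.conj_ofReal]
    ring
  have hmain : ENNReal.ofReal (‖g‖ ^ 2) ≤ eLpNorm f (ENNReal.ofReal m) volume *
      ENNReal.ofReal ((A * ‖g‖) ^ (2 - 2 / m) * (B * ‖g‖) ^ (2 / m - 1)) := by
    refine le_trans ?_ (lintegral_mul_le_of_bounded (Lp.aestronglyMeasurable f)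
      (Lp.aestronglyMeasurable h) (by positivity) (by positivity) hhb hh2 hm)
    have e1 : ENNReal.ofReal (‖g‖ ^ 2) = ‖⟪f, h⟫‖ₑ := by
      rw [← hgg, inner_self_eq_norm_sq_to_K, ← ofReal_norm]
      simp
    rw [e1, L2.inner_def]
    refine (enorm_integral_le_lintegral_enorm _).trans (lintegral_mono fun x => ?_)
    rw [RCLike.inner_apply, enorm_mul, mul_comm]
    simp
  rcases (norm_nonneg g).eq_or_lt with h0 | h0
  · simp [← h0]
  have hθ : (A * ‖g‖) ^ (2 - 2 / m) * (B * ‖g‖) ^ (2 / m - 1) =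
      ‖g‖ * (A ^ (2 - 2 / m) * B ^ (2 / m - 1)) := by
    rw [Real.mul_rpow hA0 h0.le, Real.mul_rpow hB0 h0.le]
    have : ‖g‖ ^ (2 - 2 / m) * ‖g‖ ^ (2 / m - 1) = ‖g‖ := by
      rw [← Real.rpow_add h0]
      ring_nf
      exact Real.rpow_one _
    linear_combination A ^ (2 - 2 / m) * B ^ (2 / m - 1) * this
  rw [hθ, sq, ENNReal.ofReal_mul h0.le, ENNReal.ofReal_mul h0.le, mul_left_comm] at hmain
  rw [mul_comm]
  exact (ENNReal.mul_le_mul_iff_right (by simpa using h0) ENNReal.ofReal_ne_top).1 hmain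

end HausdorffYoung

/-! ### Scaling of the low-frequency kernel and the decay exponent. -/

section Kernels

variable {n : ℕ}

theorem exists_rpow_mul_exp_neg_le {q c : ℝ} (hq : 0 ≤ q) (hc : 0 < c) :
    ∃ A : ℝ, 0 < A ∧ ∀ y : ℝ, 0 ≤ y → y ^ q * Real.exp (-(c * y)) ≤ A := by
  obtain ⟨N, hN⟩ := exists_nat_ge q
  refine ⟨1 + N.factorial / c ^ N, by positivity, fun y hy => ?_⟩
  have h1 : y ^ q ≤ 1 + y ^ N := by
    rcases le_total y 1 with h | h
    · have := Real.rpow_le_one hy h hq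
      nlinarith [pow_nonneg hy N]
    · have := Real.rpow_le_rpow_of_exponent_le h hN
      rw [Real.rpow_natCast] at this
      linarith
  have h2 : y ^ N ≤ N.factorial / c ^ N * Real.exp (c * y) := by
    have := Real.pow_div_factorial_le_exp (x := c * y) (by positivity) N
    rw [mul_pow] at this
    have e : y ^ N = N.factorial / c ^ N * (c ^ N * y ^ N / N.factorial) := by field_simp
    rw [e]
    gcongr
  have h3 : 1 ≤ Real.exp (c * y) := Real.one_le_exp (by positivity)
  rw [Real.exp_neg, ← div_eq_mul_inv, div_le_iff₀ (Real.exp_pos _)]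
  linarith

/-- The kernel which governs the low frequencies. -/
def lowKernel (α s c T : ℝ) (ξ : Freq n) : ℝ :=
  freq ξ ^ s * Real.exp (-(c * (freq ξ ^ α * T)))

theorem lowKernel_nonneg (α s c T : ℝ) (ξ : Freq n) : 0 ≤ lowKernel α s c T ξ :=
  mul_nonneg (Real.rpow_nonneg (freq_nonneg ξ) s) (Real.exp_pos _).le

theorem measurable_lowKernel (α s c T : ℝ) : Measurable (lowKernel (n := n) α s c T) :=
  (measurable_freq_rpow s).mul
    (((measurable_freq_rpow α).mul_const T).const_mul c).neg.exp

theorem exists_lowKernel_le {α s c : ℝ} (hα : 0 < α) (hs : 0 ≤ s) (hc : 0 < c) :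
    ∃ A : ℝ, 0 < A ∧ ∀ T : ℝ, 0 < T → ∀ ξ : Freq n,
      lowKernel α s c T ξ ≤ A * T ^ (-(s / α)) := by
  obtain ⟨A, hA, h⟩ := exists_rpow_mul_exp_neg_le (div_nonneg hs hα.le) hc
  refine ⟨A, hA, fun T hT ξ => ?_⟩
  have hr := freq_nonneg ξ
  have h1 := h (freq ξ ^ α * T) (by positivity)
  have e : freq ξ ^ s = (freq ξ ^ α * T) ^ (s / α) * T ^ (-(s / α)) := by
    rw [Real.mul_rpow (Real.rpow_nonneg hr _) hT.le, ← Real.rpow_mul hr,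
      mul_div_cancel₀ s hα.ne', mul_assoc, ← Real.rpow_add hT, add_neg_cancel, Real.rpow_zero,
      mul_one]
  rw [lowKernel, e, mul_right_comm]
  exact mul_le_mul_of_nonneg_right h1 (Real.rpow_nonneg hT.le _)

theorem memLp_lowKernel_one (hn : 1 ≤ n) {α s c : ℝ} (hα : 0 < α) (hs : 0 ≤ s) (hc : 0 < c) :
    MemLp (lowKernel (n := n) α s c 1) 2 volume := by
  have : Nontrivial (Freq n) := by
    have : NeZero n := ⟨by omega⟩
    infer_instance
  rw [memLp_two_iff_integrable_sq (measurable_lowKernel α s c 1).aestronglyMeasurable]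
  refine (integrable_fun_norm_addHaar (f := fun y : ℝ =>
    ((2 * Real.pi * y) ^ s * Real.exp (-(c * ((2 * Real.pi * y) ^ α * 1)))) ^ 2) volume).2 ?_
  -- In polar coordinates the volume factor adds n - 1 to the exponent 2s of the squared kernel.
  have h := (integrableOn_rpow_mul_exp_neg_mul_rpow (p := α) (s := (n - 1 : ℕ) + 2 * s)
    (b := 2 * c * (2 * Real.pi) ^ α)
    (lt_of_lt_of_le (by norm_num) (by positivity : (0 : ℝ) ≤ (n - 1 : ℕ) + 2 * s)) hα (by positivity)).const_mul ((2 * Real.pi) ^ (2 * s))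
  refine IntegrableOn.congr_fun h (fun y hy => ?_) measurableSet_Ioi
  have hy0 : (0 : ℝ) < y := hy
  simp only [finrank_euclideanSpace, Fintype.card_fin, smul_eq_mul, mul_one]
  rw [Real.mul_rpow (by positivity) hy0.le, Real.mul_rpow (by positivity) hy0.le,
    Real.rpow_add hy0, Real.rpow_natCast, mul_pow, mul_pow, ← Real.exp_nat_mul,
    ← Real.rpow_mul_natCast (by positivity), ← Real.rpow_mul_natCast hy0.le]
  push_cast
  rw [mul_comm s 2]
  ring_nf

theorem exists_eLpNorm_lowKernel_le (hn : 1 ≤ n) {α s c : ℝ} (hα : 0 < α) (hs : 0 ≤ s)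
    (hc : 0 < c) :
    ∃ B : ℝ, 0 < B ∧ ∀ T : ℝ, 0 < T → eLpNorm (lowKernel (n := n) α s c T) 2 volume ≤
      ENNReal.ofReal (B * T ^ (-((s + n / 2) / α))) := by
  have h1 := memLp_lowKernel_one hn hα hs hc
  set B := (eLpNorm (lowKernel (n := n) α s c 1) 2 volume).toReal with hB
  -- Adding 1 only makes the constant visibly positive.
  refine ⟨B + 1, by positivity, fun T hT => ?_⟩
  set R : ℝ := T ^ (1 / α) with hR
  have hR0 : 0 < R := Real.rpow_pos_of_pos hT _
  -- The kernel at T is the kernel at 1 dilated by R = T^{1/α}; the Jacobian supplies the extra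
  -- T^{-n/(2α)} in the L² norm.
  have e : lowKernel (n := n) α s c T =
      T ^ (-(s / α)) • (lowKernel α s c 1 ∘ fun ξ : Freq n => R • ξ) := by
    ext ξ
    have hr := freq_nonneg ξ
    have hf : freq (R • ξ) = R * freq ξ := by
      simp only [freq, norm_smul, Real.norm_of_nonneg hR0.le]
      ring
    have h2 : R ^ α = T := by
      rw [hR, ← Real.rpow_mul hT.le, one_div_mul_cancel hα.ne', Real.rpow_one]
    have h3 : T ^ (-(s / α)) * R ^ s = 1 := by
      rw [hR, ← Real.rpow_mul hT.le, ← Real.rpow_add hT]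
      ring_nf
      exact Real.rpow_zero _
    simp only [Pi.smul_apply, Function.comp_apply, lowKernel, hf, smul_eq_mul,
      Real.mul_rpow hR0.le hr, h2]
    rw [mul_one, mul_comm T]
    linear_combination -(freq ξ ^ s * Real.exp (-(c * (freq ξ ^ α * T)))) * h3
  rw [e, eLpNorm_const_smul]
  have hmeas : Measurable fun ξ : Freq n => R • ξ := measurable_const_smul R
  rw [← eLpNorm_map_measure (measurable_lowKernel α s c 1).aestronglyMeasurable hmeas.aemeasurable,
    Measure.map_addHaar_smul volume hR0.ne', eLpNorm_smul_measure_of_ne_top (by norm_num)]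
  rw [finrank_euclideanSpace, Fintype.card_fin, abs_of_pos (by positivity), smul_eq_mul,
    ← ENNReal.ofReal_toReal h1.eLpNorm_ne_top, ← hB,
    ENNReal.ofReal_rpow_of_nonneg (by positivity) (by simp), ← ofReal_norm,
    Real.norm_of_nonneg (by positivity), ← ENNReal.ofReal_mul (by positivity),
    ← ENNReal.ofReal_mul (by positivity)]
  refine ENNReal.ofReal_le_ofReal ?_
  have h4 : T ^ (-(s / α)) * ((R ^ n)⁻¹) ^ ((1 : ℝ≥0∞) / 2).toReal =
      T ^ (-((s + n / 2) / α)) := by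
    rw [hR, ← Real.rpow_natCast, ← Real.rpow_mul hT.le, ← Real.rpow_neg hT.le,
      ← Real.rpow_mul hT.le, ← Real.rpow_add hT]
    congr 1
    simp
    field_simp
    ring
  rw [← mul_assoc, h4, mul_comm]
  gcongr
  linarith

/-- The order of the rate of decay at low frequencies. -/
def lowOrder (σ : ℝ) : ℝ := if σ < 1 then 4 - 2 * σ else 2

theorem two_le_lowOrder (σ : ℝ) : 2 ≤ lowOrder σ := by
  unfold lowOrder; split_ifs <;> linarith

theorem four_le_lowOrder_add (σ : ℝ) : 4 ≤ lowOrder σ + 2 * σ := by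
  unfold lowOrder; split_ifs <;> linarith

/-- The rate is |ξ|⁴ / max(|ξ|², |ξ|^{2σ}); σ ≤ 2 prevents it from degenerating at high frequency.
-/
theorem one_le_rate {σ : ℝ} (hσ : σ ≤ 2) {ξ : Freq n} (h : 1 ≤ freq ξ) : 1 ≤ rate σ ξ := by
  have hr : 0 < freq ξ := by linarith
  have h1 : freq ξ ^ (2 * σ) ≤ freq ξ ^ 4 := by
    rw [← Real.rpow_natCast]
    exact Real.rpow_le_rpow_of_exponent_le h (by push_cast; linarith)
  have h2 : freq ξ ^ 2 ≤ freq ξ ^ 4 := pow_le_pow_right₀ h (by norm_num)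
  rw [rate, ratio, div_mul_eq_mul_div, one_le_div (by positivity), ← pow_add]
  exact max_le h2 h1

/-- For |ξ| ≤ 1 this reduces to the exponent inequalities α + 2 ≥ 4 and α + 2σ ≥ 4, where α is
`lowOrder σ`. -/
theorem rpow_le_rate (σ : ℝ) {ξ : Freq n} (h : freq ξ ≤ 1) :
    freq ξ ^ lowOrder σ ≤ rate σ ξ := by
  have hα := two_le_lowOrder σ
  rcases (freq_nonneg ξ).eq_or_lt with h0 | hr
  · rw [← h0, Real.zero_rpow (by linarith)]
    exact rate_nonneg σ ξ
  have h4 : freq ξ ^ 4 = freq ξ ^ (4 : ℝ) := by rw [← Real.rpow_natCast]; norm_num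
  have h2 : freq ξ ^ 2 = freq ξ ^ (2 : ℝ) := by rw [← Real.rpow_natCast]; norm_num
  rw [rate, ratio, div_mul_eq_mul_div, le_div_iff₀ (by positivity), ← pow_add, mul_max_of_nonneg _ _
    (Real.rpow_nonneg hr.le _), h4, h2, ← Real.rpow_add hr, ← Real.rpow_add hr]
  exact max_le (Real.rpow_le_rpow_of_exponent_ge hr h (by linarith))
    (Real.rpow_le_rpow_of_exponent_ge hr h (four_le_lowOrder_add σ))

theorem decayRate_eq {σ : ℝ} {m s : ℝ} (hm : 0 < m) :
    decayRate σ n m s =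
      s / lowOrder σ * (2 - 2 / m) + (s + n / 2) / lowOrder σ * (2 / m - 1) := by
  unfold decayRate lowOrder
  split_ifs with h
  · have : 2 - σ ≠ 0 := by linarith
    rw [show 4 - 2 * σ = 2 * (2 - σ) by ring]
    field_simp
    ring
  · field_simp
    ring

theorem decayRate_nonneg {σ m s : ℝ} (hm : m ∈ Set.Icc (1 : ℝ) 2) (hs : 0 ≤ s) :
    0 ≤ decayRate σ n m s := by
  have hm0 : 0 < m := by linarith [hm.1]
  have hα := two_le_lowOrder σ
  rw [decayRate_eq hm0]
  have h1 : 0 ≤ 2 - 2 / m := by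
    rw [sub_nonneg, div_le_iff₀ hm0]
    linarith [hm.1]
  have h2 : 0 ≤ 2 / m - 1 := by
    rw [sub_nonneg, le_div_iff₀ hm0]
    linarith [hm.2]
  have : 0 < lowOrder σ := by linarith
  positivity

/-- The `Lᵐ`–`L²` decay estimate at low frequencies. -/
theorem exists_low_frequency_estimate (hn : 1 ≤ n) (σ : ℝ) {m s c : ℝ}
    (hm : m ∈ Set.Icc (1 : ℝ) 2) (hs : 0 ≤ s) (hc : 0 < c) :
    ∃ C : ℝ, 0 < C ∧ ∀ T : ℝ, 0 < T → ∀ f : L2 n,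
      eLpNorm (fun ξ => ((lowKernel (lowOrder σ) s c T ξ : ℝ) : ℂ) * (𝓕 f : L2 n) ξ) 2 volume ≤
        ENNReal.ofReal (C * T ^ (-decayRate σ n m s)) *
          eLpNorm f (ENNReal.ofReal m) volume := by
  have hm0 : 0 < m := by linarith [hm.1]
  have hα : 0 < lowOrder σ := by linarith [two_le_lowOrder σ]
  obtain ⟨A, hA0, hA⟩ := exists_lowKernel_le (n := n) hα hs hc
  obtain ⟨B, hB0, hB⟩ := exists_eLpNorm_lowKernel_le hn hα hs hc
  refine ⟨A ^ (2 - 2 / m) * B ^ (2 / m - 1), by positivity, fun T hT f => ?_⟩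
  have h := eLpNorm_mul_fourier_le (measurable_lowKernel (n := n) (lowOrder σ) s c T)
    (lowKernel_nonneg _ _ _ _) (by positivity) (hA T hT) (hB T hT) hm f
  convert h using 3
  rw [Real.mul_rpow hA0.le (Real.rpow_nonneg hT.le _),
    Real.mul_rpow hB0.le (Real.rpow_nonneg hT.le _), ← Real.rpow_mul hT.le, ← Real.rpow_mul hT.le,
    mul_mul_mul_comm, ← Real.rpow_add hT, decayRate_eq hm0]
  congr 2
  ring

end Kernels

/-! ### Joining low and high frequencies. -/

section Decay

variable {n : ℕ}

theorem freq_rpow_le {s : ℝ} (hs : 0 ≤ s) (ξ : Freq n) :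
    freq ξ ^ s ≤ (1 + freq ξ ^ 2) ^ (s / 2) := by
  have hr := freq_nonneg ξ
  have e : freq ξ ^ s = (freq ξ ^ 2) ^ (s / 2) := by
    rw [← Real.rpow_natCast_mul hr]
    congr 1
    push_cast
    ring
  rw [e]
  exact Real.rpow_le_rpow (sq_nonneg _) (by linarith) (by linarith)

/-- The decaying factor at a fixed frequency, split into low and high frequencies. -/
theorem exists_freq_rpow_mul_exp_le {σ : ℝ} (hσ : σ ≤ 2) {s g c : ℝ} (hs : 0 ≤ s) (hg : 0 ≤ g)
    (hc : 0 < c) :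
    ∃ D : ℝ, 0 < D ∧ ∀ t : ℝ, 0 ≤ t → ∀ ξ : Freq n,
      freq ξ ^ s * Real.exp (-(c * (rate σ ξ * t))) ≤
        D * lowKernel (lowOrder σ) s c (1 + t) ξ +
          D * (1 + t) ^ (-g) * (1 + freq ξ ^ 2) ^ (s / 2) := by
  obtain ⟨A, hA0, hA⟩ := exists_rpow_mul_exp_neg_le hg hc
  -- The factor e^c pays for replacing t by 1 + t in both exponentials; A bounds (1+t)^g
  -- e^{-c(1+t)}.
  refine ⟨Real.exp c * (1 + A), by positivity, fun t ht ξ => ?_⟩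
  have hr := freq_nonneg ξ
  have hT : 0 < 1 + t := by linarith
  have hk := lowKernel_nonneg (lowOrder σ) s c (1 + t) ξ
  have hc1 : 0 < Real.exp c := Real.exp_pos c
  rcases le_total (freq ξ) 1 with h | h
  · have h1 := rpow_le_rate σ h
    have h2 : Real.exp (-(c * (rate σ ξ * t))) ≤
        Real.exp c * Real.exp (-(c * (freq ξ ^ lowOrder σ * (1 + t)))) := by
      rw [← Real.exp_add]
      refine Real.exp_le_exp.2 ?_
      have h3 := Real.rpow_le_one hr h (by linarith [two_le_lowOrder σ] : 0 ≤ lowOrder σ)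
      have h4 := mul_le_mul_of_nonneg_left (mul_le_mul_of_nonneg_right h1 ht) hc.le
      have h5 := mul_le_mul_of_nonneg_left h3 hc.le
      linarith
    calc freq ξ ^ s * Real.exp (-(c * (rate σ ξ * t)))
        ≤ freq ξ ^ s * (Real.exp c * Real.exp (-(c * (freq ξ ^ lowOrder σ * (1 + t))))) :=
          mul_le_mul_of_nonneg_left h2 (Real.rpow_nonneg hr s)
      _ = Real.exp c * lowKernel (lowOrder σ) s c (1 + t) ξ := by rw [lowKernel]; ring
      _ ≤ Real.exp c * (1 + A) * lowKernel (lowOrder σ) s c (1 + t) ξ + 0 := by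
          rw [add_zero, mul_assoc]
          refine mul_le_mul_of_nonneg_left ?_ hc1.le
          nlinarith
      _ ≤ _ := by gcongr; positivity
  · have h1 := one_le_rate hσ h
    have h2 : Real.exp (-(c * (rate σ ξ * t))) ≤ Real.exp c * (A * (1 + t) ^ (-g)) := by
      have h3 := hA (1 + t) hT.le
      have h4 : Real.exp (-(c * (rate σ ξ * t))) ≤ Real.exp c * Real.exp (-(c * (1 + t))) := by
        rw [← Real.exp_add]
        refine Real.exp_le_exp.2 ?_
        have := mul_le_mul_of_nonneg_left (mul_le_mul_of_nonneg_right h1 ht) hc.le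
        linarith
      refine h4.trans (mul_le_mul_of_nonneg_left ?_ hc1.le)
      rw [Real.rpow_neg hT.le, ← div_eq_mul_inv, le_div_iff₀ (by positivity)]
      linarith
    calc freq ξ ^ s * Real.exp (-(c * (rate σ ξ * t)))
        ≤ (1 + freq ξ ^ 2) ^ (s / 2) * (Real.exp c * (A * (1 + t) ^ (-g))) :=
          mul_le_mul (freq_rpow_le hs ξ) h2 (Real.exp_pos _).le (by positivity)
      _ = Real.exp c * A * (1 + t) ^ (-g) * (1 + freq ξ ^ 2) ^ (s / 2) := by ring
      _ ≤ 0 + Real.exp c * (1 + A) * (1 + t) ^ (-g) * (1 + freq ξ ^ 2) ^ (s / 2) := by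
          rw [zero_add]
          gcongr
          linarith
      _ ≤ _ := by gcongr; positivity

/-- The contribution of one datum to the decay estimate. -/
theorem exists_eLpNorm_freq_rpow_mul_exp_le (hn : 1 ≤ n) {σ : ℝ} (hσ : σ ≤ 2) {m s c : ℝ}
    (hm : m ∈ Set.Icc (1 : ℝ) 2) (hs : 0 ≤ s) (hc : 0 < c) :
    ∃ C : ℝ, 0 < C ∧ ∀ t : ℝ, 0 ≤ t → ∀ f : L2 n,
      eLpNorm (fun ξ => freq ξ ^ s * Real.exp (-(c * (rate σ ξ * t))) * ‖(𝓕 f : L2 n) ξ‖) 2 volume ≤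
        ENNReal.ofReal (C * (1 + t) ^ (-decayRate σ n m s)) * hsLmNorm m s f := by
  obtain ⟨D, hD0, hD⟩ := exists_freq_rpow_mul_exp_le (n := n) hσ hs
    (decayRate_nonneg (n := n) (σ := σ) hm hs) hc
  obtain ⟨K, hK0, hK⟩ := exists_low_frequency_estimate hn σ hm hs hc
  refine ⟨D * K + D, by positivity, fun t ht f => ?_⟩
  have hT : 0 < 1 + t := by linarith
  set T := (1 + t) ^ (-decayRate σ n m s) with hTd
  have hT0 : 0 ≤ T := Real.rpow_nonneg hT.le _
  set g₁ : Freq n → ℂ := fun ξ =>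
    ((lowKernel (lowOrder σ) s c (1 + t) ξ : ℝ) : ℂ) * (𝓕 f : L2 n) ξ with hg₁
  set g₂ : Freq n → ℂ := fun ξ =>
    (((1 + freq ξ ^ 2) ^ (s / 2) : ℝ) : ℂ) * (𝓕 f : L2 n) ξ with hg₂
  have hf := Lp.aestronglyMeasurable (𝓕 f : L2 n)
  have hm₁ : AEStronglyMeasurable g₁ volume :=
    (Complex.measurable_ofReal.comp (measurable_lowKernel _ _ _ _)).aestronglyMeasurable.mul hf
  have hm₂ : AEStronglyMeasurable g₂ volume := by
    refine AEStronglyMeasurable.mul (Measurable.aestronglyMeasurable ?_) hf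
    exact Complex.measurable_ofReal.comp
      ((measurable_const.add (continuous_freq.measurable.pow_const 2)).pow_const _)
  calc eLpNorm (fun ξ => freq ξ ^ s * Real.exp (-(c * (rate σ ξ * t))) * ‖(𝓕 f : L2 n) ξ‖) 2 volume
      ≤ eLpNorm ((D • fun ξ => ‖g₁ ξ‖) + ((D * T) • fun ξ => ‖g₂ ξ‖)) 2 volume := by
        refine eLpNorm_mono_real fun ξ => ?_
        have h1 := mul_le_mul_of_nonneg_right (hD t ht ξ) (norm_nonneg ((𝓕 f : L2 n) ξ))
        have hr := freq_nonneg ξ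
        rw [Real.norm_of_nonneg (by positivity)]
        refine h1.trans_eq ?_
        simp only [Pi.add_apply, Pi.smul_apply, smul_eq_mul, hg₁, hg₂, norm_mul, Complex.norm_real]
        rw [Real.norm_of_nonneg (lowKernel_nonneg _ _ _ _ _), Real.norm_of_nonneg (by positivity)]
        ring
    _ ≤ eLpNorm (D • fun ξ => ‖g₁ ξ‖) 2 volume + eLpNorm ((D * T) • fun ξ => ‖g₂ ξ‖) 2 volume :=
        eLpNorm_add_le (hm₁.norm.const_smul D) (hm₂.norm.const_smul (D * T)) (by norm_num)
    _ = ENNReal.ofReal D * eLpNorm g₁ 2 volume + ENNReal.ofReal (D * T) * hNorm s f := by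
        rw [eLpNorm_const_smul, eLpNorm_const_smul, eLpNorm_norm, eLpNorm_norm,
          Real.enorm_of_nonneg hD0.le, Real.enorm_of_nonneg (by positivity)]
        rfl
    _ ≤ ENNReal.ofReal D * (ENNReal.ofReal (K * T) * eLpNorm f (ENNReal.ofReal m) volume) +
          ENNReal.ofReal (D * T) * hNorm s f := by
        gcongr
        exact hK (1 + t) hT f
    _ ≤ ENNReal.ofReal ((D * K + D) * T) * eLpNorm f (ENNReal.ofReal m) volume +
          ENNReal.ofReal ((D * K + D) * T) * hNorm s f := by
        rw [← mul_assoc, ← ENNReal.ofReal_mul hD0.le]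
        have h1 : D * (K * T) ≤ (D * K + D) * T := by nlinarith [mul_nonneg hD0.le hT0]
        have h2 : D * T ≤ (D * K + D) * T := by
          nlinarith [mul_nonneg (mul_nonneg hD0.le hK0.le) hT0]
        gcongr
    _ = _ := by rw [hsLmNorm, mul_add, add_comm]

/-- Both represent -Δu₀, and an L² function is determined by its distribution. -/
theorem IsSolution.p_zero_eq {σ : ℝ} {u₀ : Distr n} {p₀ u₁ θ₀ : L2 n} {u : ℝ → Distr n}
    {p v θ : ℝ → L2 n} (h : IsSolution σ u₀ u₁ θ₀ u p v θ) (hp₀ : -Δ u₀ = (p₀ : Distr n)) :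
    p 0 = p₀ := by
  have h1 := h.neg_laplacian_u 0 le_rfl
  rw [h.initial_u, hp₀] at h1
  have hker := Lp.ker_toTemperedDistributionCLM_eq_bot (E := Freq n) (F := ℂ) (μ := volume)
    (p := 2)
  rw [LinearMap.ker_eq_bot'] at hker
  refine sub_eq_zero.1 (hker _ ?_)
  change Lp.toTemperedDistributionCLM ℂ volume 2 (p 0 - p₀) = 0
  rw [map_sub, Lp.toTemperedDistributionCLM_apply, Lp.toTemperedDistributionCLM_apply, ← h1,
    sub_self]

/-- A function dominated pointwise by decaying data satisfies the decay estimate. -/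
theorem hdotNorm_le_of_ae_le {s : ℝ} {E : Freq n → ℝ} (hE : Measurable E)
    {f f₁ f₂ f₃ : L2 n}
    (h : ∀ᵐ ξ, ‖(𝓕 f : L2 n) ξ‖ ≤ 2 * E ξ * (‖(𝓕 f₁ : L2 n) ξ‖ + ‖(𝓕 f₂ : L2 n) ξ‖ +
      ‖(𝓕 f₃ : L2 n) ξ‖)) :
    hdotNorm s f ≤ 2 * (eLpNorm (fun ξ => freq ξ ^ s * E ξ * ‖(𝓕 f₁ : L2 n) ξ‖) 2 volume +
      eLpNorm (fun ξ => freq ξ ^ s * E ξ * ‖(𝓕 f₂ : L2 n) ξ‖) 2 volume +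
      eLpNorm (fun ξ => freq ξ ^ s * E ξ * ‖(𝓕 f₃ : L2 n) ξ‖) 2 volume) := by
  set G : L2 n → Freq n → ℝ := fun f ξ => freq ξ ^ s * E ξ * ‖(𝓕 f : L2 n) ξ‖ with hG
  have hGm : ∀ f, AEStronglyMeasurable (G f) volume := fun f =>
    ((measurable_freq_rpow s).mul hE).aestronglyMeasurable.mul
      (Lp.aestronglyMeasurable (𝓕 f : L2 n)).norm
  have h1 : hdotNorm s f ≤ eLpNorm ((2 : ℝ) • (G f₁ + G f₂ + G f₃)) 2 volume := by
    refine eLpNorm_mono_ae_real ?_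
    filter_upwards [h] with ξ hξ
    have hr := Real.rpow_nonneg (freq_nonneg ξ) s
    rw [norm_mul, Complex.norm_real, Real.norm_of_nonneg hr]
    refine (mul_le_mul_of_nonneg_left hξ hr).trans_eq ?_
    simp only [Pi.smul_apply, Pi.add_apply, hG, smul_eq_mul]
    ring
  refine h1.trans ?_
  rw [eLpNorm_const_smul, Real.enorm_of_nonneg (by norm_num), ENNReal.ofReal_ofNat]
  gcongr
  refine (eLpNorm_add_le ((hGm f₁).add (hGm f₂)) (hGm f₃) (by norm_num)).trans ?_
  gcongr
  exact eLpNorm_add_le (hGm f₁) (hGm f₂) (by norm_num)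

theorem norm_le_of_sq_sum_le {X a b d x y z r : ℝ} (hX : X ^ 2 ≤ r)
    (hr : r ≤ 4 * Real.exp d * (x ^ 2 + y ^ 2 + z ^ 2)) (hd : a = d / 2) (hb : b = Real.exp a)
    (hx : 0 ≤ x) (hy : 0 ≤ y) (hz : 0 ≤ z) : X ≤ 2 * b * (x + y + z) := by
  have hb0 : 0 < b := hb ▸ Real.exp_pos a
  have e : Real.exp d = b ^ 2 := by
    rw [hb, ← Real.exp_nat_mul, hd]
    congr 1
    push_cast
    ring
  refine le_of_sq_le_sq ?_ (by positivity)
  rw [e] at hr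
  have : b ^ 2 * (x ^ 2 + y ^ 2 + z ^ 2) ≤ b ^ 2 * (x + y + z) ^ 2 := by
    gcongr
    nlinarith [mul_nonneg hx hy, mul_nonneg hx hz, mul_nonneg hy hz]
  nlinarith

end Decay

end ThermoPlate

end

/-! ### The decay estimate. -/

theorem mainTheorem6 (n : ℕ) (hn : 1 ≤ n) (σ : ℝ) (hσ : σ ∈ Set.Icc (0 : ℝ) 2)
    (m : ℝ) (hm : m ∈ Set.Icc (1 : ℝ) 2) (s : ℝ) (hs : 0 ≤ s) :
    ∃ C : ℝ, 0 < C ∧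
      ∀ (u₀ : ThermoPlate.Distr n) (p₀ u₁ θ₀ : ThermoPlate.L2 n),
        -Δ u₀ = (p₀ : ThermoPlate.Distr n) →
        ThermoPlate.MemHsLm m s p₀ →
        ThermoPlate.MemHsLm m s u₁ →
        ThermoPlate.MemHsLm m s θ₀ →
        ∀ (u : ℝ → ThermoPlate.Distr n) (p v θ : ℝ → ThermoPlate.L2 n),
          ThermoPlate.IsSolution σ u₀ u₁ θ₀ u p v θ →
          ∀ t : ℝ, 0 ≤ t →
            ThermoPlate.hdotNorm s (p t) + ThermoPlate.hdotNorm s (v t)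
                + ThermoPlate.hdotNorm s (θ t) ≤
              ENNReal.ofReal (C * (1 + t) ^ (-ThermoPlate.decayRate σ n m s)) *
                (ThermoPlate.hsLmNorm m s p₀ + ThermoPlate.hsLmNorm m s u₁
                  + ThermoPlate.hsLmNorm m s θ₀) := by
  obtain ⟨K, hK0, hK⟩ := ThermoPlate.exists_eLpNorm_freq_rpow_mul_exp_le hn hσ.2 hm hs
    -- Taking square roots of the pointwise bound halves the rate 1/512.
    (c := 1 / 1024) (by norm_num)
  -- Three components, each bounded with the factor 2 = √4 from the pointwise estimate.
  refine ⟨6 * K, by positivity, ?_⟩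
  intro u₀ p₀ u₁ θ₀ hp₀ _ _ _ u p v θ h t ht
  have hae := h.ae_norm_fourier_le (by constructor <;> linarith [hσ.1, hσ.2]) ht
  rw [h.p_zero_eq hp₀, h.initial_v, h.initial_θ] at hae
  set E : ThermoPlate.Freq n → ℝ := fun ξ =>
    Real.exp (-(1 / 1024 * (ThermoPlate.rate σ ξ * t))) with hE
  have hEm : Measurable E :=
    (((ThermoPlate.measurable_rate σ).mul_const t).const_mul (1 / 1024)).neg.exp
  have hall : ∀ f : ThermoPlate.L2 n,
      (∀ᵐ ξ, ‖(𝓕 f : ThermoPlate.L2 n) ξ‖ ^ 2 ≤ ‖(𝓕 (p t) : ThermoPlate.L2 n) ξ‖ ^ 2 +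
        ‖(𝓕 (v t) : ThermoPlate.L2 n) ξ‖ ^ 2 + ‖(𝓕 (θ t) : ThermoPlate.L2 n) ξ‖ ^ 2) →
      ThermoPlate.hdotNorm s f ≤
        2 * (ENNReal.ofReal (K * (1 + t) ^ (-ThermoPlate.decayRate σ n m s)) *
          (ThermoPlate.hsLmNorm m s p₀ + ThermoPlate.hsLmNorm m s u₁
            + ThermoPlate.hsLmNorm m s θ₀)) := fun f hf => by
    refine (ThermoPlate.hdotNorm_le_of_ae_le hEm (f₁ := p₀) (f₂ := u₁) (f₃ := θ₀) ?_).trans ?_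
    · filter_upwards [hf, hae] with ξ h1 h2
      exact ThermoPlate.norm_le_of_sq_sum_le h1 h2 (by ring) rfl (norm_nonneg _) (norm_nonneg _)
        (norm_nonneg _)
    · rw [mul_add (ENNReal.ofReal _), mul_add (ENNReal.ofReal _)]
      gcongr
      · exact hK t ht p₀
      · exact hK t ht u₁
      · exact hK t ht θ₀
  have h1 := hall (p t) (.of_forall fun ξ => by
    linarith [sq_nonneg ‖(𝓕 (v t) : ThermoPlate.L2 n) ξ‖,
      sq_nonneg ‖(𝓕 (θ t) : ThermoPlate.L2 n) ξ‖])
  have h2 := hall (v t) (.of_forall fun ξ => by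
    linarith [sq_nonneg ‖(𝓕 (p t) : ThermoPlate.L2 n) ξ‖,
      sq_nonneg ‖(𝓕 (θ t) : ThermoPlate.L2 n) ξ‖])
  have h3 := hall (θ t) (.of_forall fun ξ => by
    linarith [sq_nonneg ‖(𝓕 (p t) : ThermoPlate.L2 n) ξ‖,
      sq_nonneg ‖(𝓕 (v t) : ThermoPlate.L2 n) ξ‖])
  refine (add_le_add (add_le_add h1 h2) h3).trans_eq ?_
  rw [mul_assoc 6 K, ENNReal.ofReal_mul (by norm_num : (0 : ℝ) ≤ 6), ENNReal.ofReal_ofNat]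
  ring
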